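/- For $n\ge 1$ choose a mapping $f:\{1,\dots,n\}\to\{1,\dots,n\}$ uniformly at random among all $n^n$ mappings. Its components are the connected components of the undirected graph on $\{1,\dots,n\}$ in which $i$ is joined to $f(i)$ for every $i$. Likewise, for $n\ge 3$ choose uniformly at random a $2$-regular labeled graph, i.e. a simple undirected graph on the vertex set $\{1,\dots,n\}$ in which every vertex has degree $2$. In either model let $\Lambda_n$ be the number of vertices of a largest component. A median of $\Lambda_n$ is a real number $m$ with $P(\Lambda_n\le m)\ge\frac12$ and $P(\Lambda_n\ge m)\ge\frac12$; such an $m$ exists for every $n$ considered. Then, in each of the two models: (i) for every choice of medians ${}_L\nu_n$ of $\Lambda_n$, $$\lim_{n\to\infty}\frac{{}_L\nu_n}{n}=\frac{4e}{(1+e)^2}=0.78644773296592741014\ldots;$$ (ii) for every $x\in[\frac12,1]$, $$\lim_{n\to\infty}P(\Lambda_n>xn)=\int_x^1\frac{dy}{2y\sqrt{1-y}}.$$ -/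

import Mathlib

namespace RandomStructures

/-- Probability of the event `p` for an element chosen uniformly from the finite type `α`. -/
noncomputable def uniformProb {α : Type*} (p : α → Prop) : ℝ :=
  (Nat.card {a : α // p a} : ℝ) / (Nat.card α : ℝ)

/-- `m` is a median of `X a`, where `a` is uniform on the finite type `α`. -/
def IsMedian {α : Type*} (X : α → ℕ) (m : ℝ) : Prop :=
  1 / 2 ≤ uniformProb (fun a => (X a : ℝ) ≤ m) ∧
    1 / 2 ≤ uniformProb (fun a => m ≤ (X a : ℝ))

/-- The number of vertices of a largest connected component of a finite graph
(`0` if there are no vertices). -/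
noncomputable def largestComponent {V : Type*} (G : SimpleGraph V) : ℕ :=
  ⨆ c : G.ConnectedComponent, c.supp.ncard

/-- Mappings of an `n`-element labeled set to itself. -/
abbrev Mapping (n : ℕ) : Type := Fin n → Fin n

/-- The underlying undirected graph of a mapping: `i` is joined to `f i` for every `i`.
Loops, which have no influence on connectedness, are dropped. -/
def Mapping.graph {n : ℕ} (f : Mapping n) : SimpleGraph (Fin n) :=
  SimpleGraph.fromRel (fun i j => f i = j)

/-- Size of the largest component of a mapping. -/
noncomputable def Mapping.largest {n : ℕ} (f : Mapping n) : ℕ :=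
  largestComponent (Mapping.graph f)

open Classical in
/-- Labeled simple undirected graphs on `n` vertices in which every vertex has degree `2`. -/
def TwoRegularGraph (n : ℕ) : Type :=
  {G : SimpleGraph (Fin n) // G.IsRegularOfDegree 2}

/-- Size of the largest component of a `2`-regular graph. -/
noncomputable def TwoRegularGraph.largest {n : ℕ} (G : TwoRegularGraph n) : ℕ :=
  largestComponent G.1

end RandomStructures

/-!
Both models are labeled classes whose objects are sets of connected ones. If `t n` and `c k` count
all objects on `n` labels and the connected ones on `k` labels, then for `x ≥ 1 / 2` at most one
component has more than `x n` vertices, so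

`P (Λₙ > x n) = ∑ k ∈ (x n, n], (n choose k) c k t (n - k) / t n`.

In both models `c k / (k! ρ ^ k) ~ 1 / (2 k)` and `t n / (n! ρ ^ n) ~ A / √n`, so this sum is a
Riemann sum for `∫ y in x..1, 1 / (2 y √(1 - y)) = artanh √(1 - x)`. The integral takes the value
`1 / 2` at `x = 1 - tanh² (1 / 2) = 4 e / (1 + e) ²`, and its strict monotonicity carries the limit
law over to the medians.

For mappings `ρ = e` and `t n = n ^ n`; Abel's identity gives `c k = (k - 1)! ∑ j < k, k ^ j / j!`,
and the sum is `~ e ^ k / 2` by the central limit theorem for Poisson variables. A connected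
`2`-regular graph is a full cycle up to orientation, so `ρ = 1`, `c k = (k - 1)! / 2` for `k ≥ 3`,
and the exponential generating function of `t` is `exp (- X / 2 - X² / 4) (1 - X) ^ (-1 / 2)`.
-/

open Filter Topology Set MeasureTheory

namespace RandomStructures

/-! ### The limit distribution -/

theorem hasDerivAt_artanh {x : ℝ} (hx : x ∈ Ioo (-1) 1) :
    HasDerivAt Real.artanh (1 / (1 - x ^ 2)) x := by
  have hadd : 0 < 1 + x := by linarith [hx.1]
  have hsub : 0 < 1 - x := by linarith [hx.2]
  have hlog : HasDerivAt (fun t : ℝ => (Real.log (1 + t) - Real.log (1 - t)) / 2)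
      (1 / (1 - x ^ 2)) x := by
    convert! ((((hasDerivAt_id x).const_add 1).log hadd.ne').sub
      (((hasDerivAt_id x).const_sub 1).log hsub.ne')).div_const 2 using 1
    rw [show 1 - x ^ 2 = (1 + x) * (1 - x) by ring]
    simp only [id]
    field_simp
    ring
  refine hlog.congr_of_eventuallyEq ?_
  filter_upwards [Ioo_mem_nhds hx.1 hx.2] with t ht
  rw [Real.artanh_eq_half_log (Ioo_subset_Icc_self ht),
    Real.log_div (by linarith [ht.1]) (by linarith [ht.2])]
  ring

theorem sqrt_one_sub_mem_Ico {x : ℝ} (hx : 0 < x) : √(1 - x) ∈ Ico 0 1 :=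
  ⟨Real.sqrt_nonneg _, (Real.sqrt_lt' one_pos).2 (by linarith)⟩

theorem integral_tail_eq_artanh {x : ℝ} (hx : x ∈ Ioc 0 1) :
    ∫ y in x..1, 1 / (2 * y * √(1 - y)) = Real.artanh √(1 - x) := by
  have hmem : ∀ y, 0 < y → √(1 - y) ∈ Ioo (-1) 1 := fun y hy =>
    Ico_subset_Ioo_left (by norm_num) (sqrt_one_sub_mem_Ico hy)
  have hcont : ContinuousOn (fun y => -Real.artanh √(1 - y)) (Icc x 1) := fun y hy =>
    ((hasDerivAt_artanh (hmem y (hx.1.trans_le hy.1))).continuousAt.comp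
      (f := fun y => √(1 - y)) (by fun_prop)).neg.continuousWithinAt
  have hderiv : ∀ y ∈ Ioo x 1,
      HasDerivAt (fun y => -Real.artanh √(1 - y)) (1 / (2 * y * √(1 - y))) y := by
    intro y hy
    have hpos : 0 < 1 - y := by linarith [hy.2]
    have hsqrt := ((hasDerivAt_id y).const_sub 1).sqrt hpos.ne'
    convert! ((hasDerivAt_artanh (hmem y (hx.1.trans hy.1))).comp y hsqrt).neg using 1
    simp only [id, Real.sq_sqrt hpos.le, sub_sub_cancel]
    field_simp
  have hnonneg : ∀ y ∈ Ioo x 1, 0 ≤ 1 / (2 * y * √(1 - y)) := fun y hy => by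
    have := hx.1.trans hy.1
    positivity
  rw [intervalIntegral.integral_eq_sub_of_hasDerivAt_of_le hx.2 hcont hderiv
    (intervalIntegral.intervalIntegrable_deriv_of_nonneg (by rwa [uIcc_of_le hx.2])
      (by simpa only [min_eq_left hx.2, max_eq_right hx.2] using hderiv)
      (by simpa only [min_eq_left hx.2, max_eq_right hx.2] using hnonneg))]
  simp

theorem strictAntiOn_integral_tail :
    StrictAntiOn (fun x : ℝ => ∫ y in x..1, 1 / (2 * y * √(1 - y))) (Ioc 0 1) := by
  intro x hx y hy hxy
  simp only [integral_tail_eq_artanh hx, integral_tail_eq_artanh hy]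
  exact Real.artanh_lt_artanh (by linarith [Real.sqrt_nonneg (1 - y)])
    (sqrt_one_sub_mem_Ico hx.1).2
    (Real.sqrt_lt_sqrt (by linarith [hy.2]) (by linarith))

theorem limit_constant_eq_one_sub_tanh_sq :
    4 * Real.exp 1 / (1 + Real.exp 1) ^ 2 = 1 - Real.tanh (1 / 2) ^ 2 := by
  have hsq : Real.exp 1 = Real.exp (1 / 2) ^ 2 := by rw [← Real.exp_nat_mul]; norm_num
  rw [Real.tanh_eq, Real.exp_neg, hsq]
  field_simp
  ring

theorem limit_constant_bounds :
    0.78644773296592741014 ≤ 4 * Real.exp 1 / (1 + Real.exp 1) ^ 2 ∧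
      4 * Real.exp 1 / (1 + Real.exp 1) ^ 2 < 0.78644773296592741015 := by
  -- `Real.exp_one_near_20` is not sharp enough for the upper bound.
  have htaylor := abs_sub_le_iff.1 (Real.exp_bound (x := 1) (by simp) (n := 24) (by norm_num))
  norm_num [Finset.sum_range_succ, Nat.factorial] at htaylor
  rw [le_div_iff₀ (by positivity), div_lt_iff₀ (by positivity)]
  constructor <;> nlinarith [htaylor.1, htaylor.2]

theorem integral_tail_limit_constant :
    ∫ y in (4 * Real.exp 1 / (1 + Real.exp 1) ^ 2)..1, 1 / (2 * y * √(1 - y)) = 1 / 2 := by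
  have hpos : (0 : ℝ) < 4 * Real.exp 1 / (1 + Real.exp 1) ^ 2 := by positivity
  rw [limit_constant_eq_one_sub_tanh_sq] at *
  rw [integral_tail_eq_artanh ⟨hpos, by linarith [sq_nonneg (Real.tanh (1 / 2))]⟩,
    sub_sub_cancel, Real.sqrt_sq, Real.artanh_tanh]
  rw [Real.tanh_eq_sinh_div_cosh]
  exact div_nonneg (Real.sinh_nonneg_iff.2 (by norm_num)) (Real.cosh_pos _).le

/-! ### Medians -/

theorem uniformProb_congr {α β : Type*} (e : α ≃ β) {p : α → Prop} {q : β → Prop}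
    (h : ∀ a, p a ↔ q (e a)) : uniformProb p = uniformProb q := by
  rw [uniformProb, uniformProb, Nat.card_congr e, Nat.card_congr (e.subtypeEquiv h)]

section Median

variable {α : Type*} [Finite α]

theorem uniformProb_mono {p q : α → Prop} (h : ∀ a, p a → q a) :
    uniformProb p ≤ uniformProb q := by
  unfold uniformProb
  gcongr
  exact Nat.card_le_card_of_injective (Subtype.map id h) (Subtype.map_injective h fun _ _ h => h)

theorem uniformProb_eq_one [Nonempty α] {p : α → Prop} (h : ∀ a, p a) : uniformProb p = 1 := by
  rw [uniformProb, Nat.card_congr (Equiv.subtypeUnivEquiv h),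
    div_self (by exact_mod_cast Nat.card_pos.ne')]

theorem uniformProb_add_not [Nonempty α] (p : α → Prop) :
    uniformProb p + uniformProb (fun a => ¬ p a) = 1 := by
  classical
  rw [uniformProb, uniformProb, ← add_div, div_eq_one_iff_eq (by exact_mod_cast Nat.card_pos.ne')]
  exact_mod_cast Nat.card_sum.symm.trans (Nat.card_congr (Equiv.sumCompl p))

theorem exists_isMedian [Nonempty α] (X : α → ℕ) : ∃ m : ℝ, IsMedian X m := by
  classical
  have hex : ∃ k : ℕ, 1 / 2 ≤ uniformProb (fun a => (X a : ℝ) ≤ k) := by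
    obtain ⟨M, hM⟩ := (Set.finite_range X).bddAbove
    refine ⟨M, ?_⟩
    rw [uniformProb_eq_one fun a => by exact_mod_cast hM ⟨a, rfl⟩]
    norm_num
  refine ⟨Nat.find hex, Nat.find_spec hex, ?_⟩
  rcases hk : Nat.find hex with _ | k
  · rw [uniformProb_eq_one fun a => by simp]
    norm_num
  · have hlt : uniformProb (fun a => (X a : ℝ) ≤ k) < 1 / 2 :=
      not_le.1 (Nat.find_min hex (by omega))
    have hnot := uniformProb_add_not fun a => (X a : ℝ) ≤ k
    have hmono : uniformProb (fun a => ¬ (X a : ℝ) ≤ k) ≤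
        uniformProb fun a => ((k + 1 : ℕ) : ℝ) ≤ X a :=
      uniformProb_mono fun a ha => by exact_mod_cast not_le.1 ha
    linarith

theorem IsMedian.le_of_uniformProb_lt {X : α → ℕ} {m t : ℝ} (hm : IsMedian X m)
    (ht : uniformProb (fun a => t < (X a : ℝ)) < 1 / 2) : m ≤ t := by
  by_contra! htm
  have := uniformProb_mono (p := fun a => m ≤ (X a : ℝ)) fun a ha => htm.trans_le ha
  linarith [hm.2]

theorem IsMedian.lt_of_lt_uniformProb {X : α → ℕ} {m t : ℝ} (hm : IsMedian X m)
    (ht : 1 / 2 < uniformProb (fun a => t < (X a : ℝ))) : t < m := by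
  by_contra! hmt
  have hne : Nonempty α := by
    by_contra hempty
    rw [not_nonempty_iff] at hempty
    norm_num [uniformProb] at ht
  have hnot := uniformProb_add_not fun a => t < (X a : ℝ)
  have := uniformProb_mono (p := fun a => (X a : ℝ) ≤ m) fun a ha => not_lt.2 (ha.trans hmt)
  linarith [hm.1]

end Median

theorem tendsto_median_div {ι : Type*} {l : Filter ι} {α : ι → Type*} [∀ i, Finite (α i)]
    {X : ∀ i, α i → ℕ} {c ν : ι → ℝ} {F : ℝ → ℝ} {s : Set ℝ} {x₀ : ℝ}
    (hc : ∀ᶠ i in l, 0 < c i) (hs : s ∈ 𝓝 x₀) (hF : StrictAntiOn F s) (hx₀ : F x₀ = 1 / 2)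
    (hX : ∀ x ∈ s, Tendsto (fun i => uniformProb fun a => x * c i < (X i a : ℝ)) l (𝓝 (F x)))
    (hν : ∀ᶠ i in l, IsMedian (X i) (ν i)) :
    Tendsto (fun i => ν i / c i) l (𝓝 x₀) := by
  have hmem := mem_of_mem_nhds hs
  refine tendsto_order.2 ⟨fun b hb => ?_, fun b hb => ?_⟩
  · obtain ⟨x, hxs, hbx, hxx₀⟩ :=
      Filter.nonempty_of_mem (inter_mem (mem_nhdsWithin_of_mem_nhds hs) (Ioo_mem_nhdsLT hb))
    filter_upwards [hν, hc, (hX x hxs).eventually_const_lt (hx₀ ▸ hF hxs hmem hxx₀)]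
      with i hmedian hpos hprob
    rw [lt_div_iff₀ hpos]
    exact (mul_lt_mul_of_pos_right hbx hpos).trans (hmedian.lt_of_lt_uniformProb hprob)
  · obtain ⟨x, hxs, hx₀x, hxb⟩ :=
      Filter.nonempty_of_mem (inter_mem (mem_nhdsWithin_of_mem_nhds hs) (Ioo_mem_nhdsGT hb))
    filter_upwards [hν, hc, (hX x hxs).eventually_lt_const (hx₀ ▸ hF hmem hxs hx₀x)]
      with i hmedian hpos hprob
    rw [div_lt_iff₀ hpos]
    exact (hmedian.le_of_uniformProb_lt hprob).trans_lt (mul_lt_mul_of_pos_right hxb hpos)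

/-! ### Tails of convolutions -/

theorem intervalIntegral_comp_natFloor (H : ℕ → ℝ) (N : ℕ) :
    ∫ t in (0 : ℝ)..N, H ⌊t⌋₊ = ∑ j ∈ Finset.range N, H j := by
  have hpiece (j : ℕ) : EqOn (fun _ => H j) (fun t : ℝ => H ⌊t⌋₊) (Ioo j (j + 1 : ℕ)) := by
    intro t ht
    simp only
    rw [(Nat.floor_eq_iff (j.cast_nonneg.trans ht.1.le)).2 ⟨ht.1.le, by exact_mod_cast ht.2⟩]
  have hle (j : ℕ) : (j : ℝ) ≤ (j + 1 : ℕ) := by simp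
  rw [← Nat.cast_zero, ← intervalIntegral.sum_integral_adjacent_intervals
    (a := fun j : ℕ => (j : ℝ)) fun j _ => intervalIntegrable_const.congr_uIoo
      (uIoo_of_le (hle j) ▸ hpiece j)]
  refine Finset.sum_congr rfl fun j _ => ?_
  rw [← intervalIntegral.integral_congr_Ioo_of_le (hle j) (hpiece j)]
  simp

theorem tendsto_natFloor_natCast_mul_div {u : ℝ} (hu : 0 ≤ u) :
    Tendsto (fun n : ℕ => (⌊(n : ℝ) * u⌋₊ : ℝ) / n) atTop (𝓝 u) := by
  simpa only [Function.comp_def, mul_comm] using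
    (tendsto_nat_floor_mul_div_atTop hu).comp tendsto_natCast_atTop_atTop

theorem tendsto_mul_rpow_comp_sub {p : ℕ → ℝ} {α A : ℝ}
    (hp : Tendsto (fun n : ℕ => p n * (n : ℝ) ^ α) atTop (𝓝 A)) (j : ℕ) (c : ℝ) (hc : 0 ≤ c + j) :
    Tendsto (fun n : ℕ => p (n - j) * ((n : ℝ) + c) ^ α) atTop (𝓝 A) := by
  rw [← tendsto_add_atTop_iff_nat j]
  have hratio : Tendsto (fun n : ℕ => ((n + (c + j)) / (n : ℝ)) ^ α) atTop (𝓝 1) := by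
    have h := tendsto_add_mul_div_add_mul_atTop_nhds (c + j) 0 1 (one_ne_zero (α := ℝ))
    simpa [add_comm] using h.rpow_const (p := α) (.inl (by norm_num))
  rw [← mul_one A]
  refine (hp.mul hratio).congr' ?_
  filter_upwards [eventually_gt_atTop 0] with n hn
  rw [Real.div_rpow (by positivity) (by positivity), mul_assoc, mul_div_cancel₀ _
    (by positivity), Nat.add_sub_cancel]
  push_cast
  ring_nf

theorem exists_forall_abs_mul_rpow_le {p : ℕ → ℝ} {α A : ℝ}
    (hp : Tendsto (fun n : ℕ => p n * (n : ℝ) ^ α) atTop (𝓝 A)) :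
    ∃ B, ∀ n : ℕ, |p n| * ((n : ℝ) + 1) ^ α ≤ B := by
  obtain ⟨B, hB⟩ := isBounded_iff_forall_norm_le.1 <| Metric.isBounded_range_of_tendsto _ <|
    tendsto_mul_rpow_comp_sub hp 0 1 (by norm_num)
  refine ⟨B, fun n => ?_⟩
  have := hB _ (mem_range_self n)
  rwa [norm_mul, Real.norm_eq_abs, Real.norm_of_nonneg (by positivity), Nat.sub_zero] at this

theorem rpow_natFloor_succ_le {α u : ℝ} {n : ℕ} (hn : 0 < n) (hu : u ∈ Ioc (0 : ℝ) 1) :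
    ((⌊(n : ℝ) * u⌋₊ : ℝ) + 1) ^ (-α) ≤ (n : ℝ) ^ (-α) * (u ^ (-α) + 2 ^ (-α)) := by
  have hn1 : (1 : ℝ) ≤ n := by exact_mod_cast hn
  have hlt := Nat.lt_floor_add_one ((n : ℝ) * u)
  have hle := Nat.floor_le (show 0 ≤ (n : ℝ) * u from mul_nonneg n.cast_nonneg hu.1.le)
  have hu0 := hu.1
  rw [mul_add, ← Real.mul_rpow (by positivity) hu0.le,
    ← Real.mul_rpow (by positivity) zero_le_two]
  rcases le_total 0 α with hα | hα
  · exact (Real.rpow_le_rpow_of_nonpos (by positivity) hlt.le (by linarith)).trans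
      (le_add_of_nonneg_right (by positivity))
  · refine (Real.rpow_le_rpow (by positivity) ?_ (by linarith)).trans
      (le_add_of_nonneg_left (by positivity))
    nlinarith [hu.2]

/-- The step function on `[0, 1]` whose integral is the part `k > x * n` of the convolution
`∑ k, q k * p (n - k)`, divided by `p n`; the variable `u` stands for `(n - k) / n`. -/
noncomputable def tailDensity (p q : ℕ → ℝ) (x : ℝ) (n : ℕ) (u : ℝ) : ℝ :=
  let j := ⌊(n : ℝ) * u⌋₊
  if x * n < (n - j : ℕ) then (n : ℝ) * (q (n - j) * p j) / p n else 0

section TailDensity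

variable {p q : ℕ → ℝ} {x : ℝ}

theorem measurable_tailDensity (n : ℕ) : Measurable (tailDensity p q x n) :=
  (measurable_from_top (f := fun j : ℕ =>
    if x * n < (n - j : ℕ) then (n : ℝ) * (q (n - j) * p j) / p n else 0)).comp
    (Nat.measurable_floor.comp (measurable_const_mul (n : ℝ)))

theorem integral_tailDensity (hx : 0 ≤ x) {n : ℕ} (hn : 0 < n) :
    ∫ u in (0 : ℝ)..1, tailDensity p q x n u =
      (∑ k ∈ (Finset.range (n + 1)).filter (fun k : ℕ => x * n < k), q k * p (n - k)) / p n := by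
  have hn' : (n : ℝ) ≠ 0 := by exact_mod_cast hn.ne'
  simp only [tailDensity]
  rw [intervalIntegral.integral_comp_mul_left (fun t : ℝ =>
    if x * n < (n - ⌊t⌋₊ : ℕ) then (n : ℝ) * (q (n - ⌊t⌋₊) * p ⌊t⌋₊) / p n else 0) hn',
    mul_zero, mul_one, intervalIntegral_comp_natFloor (fun j =>
    if x * n < (n - j : ℕ) then (n : ℝ) * (q (n - j) * p j) / p n else 0),
    Finset.sum_filter, ← Finset.sum_range_reflect _ (n + 1), Finset.sum_range_succ]
  have hlast : ¬ x * n < ((n + 1 - 1 - n : ℕ) : ℝ) := by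
    simpa using mul_nonneg hx n.cast_nonneg
  rw [if_neg hlast, add_zero, Finset.sum_div, smul_eq_mul, Finset.mul_sum]
  refine Finset.sum_congr rfl fun j hj => ?_
  have hsub : n - (n - j) = j := by have := Finset.mem_range.1 hj; omega
  simp only [add_tsub_cancel_right, hsub]
  split_ifs
  · field_simp
  · simp

theorem natFloor_natCast_mul_le {u : ℝ} (hu : u ≤ 1) (n : ℕ) : ⌊(n : ℝ) * u⌋₊ ≤ n :=
  Nat.floor_le_of_le (mul_le_of_le_one_right n.cast_nonneg hu)

theorem exists_norm_tailDensity_le {α κ A : ℝ} (hA : A ≠ 0)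
    (hp : Tendsto (fun n : ℕ => p n * (n : ℝ) ^ α) atTop (𝓝 A))
    (hq : Tendsto (fun k : ℕ => (k : ℝ) * q k) atTop (𝓝 κ)) (hx : 0 < x) :
    ∃ C, ∀ᶠ n : ℕ in atTop, ∀ u ∈ Ioc (0 : ℝ) 1,
      ‖tailDensity p q x n u‖ ≤ C * (u ^ (-α) + 2 ^ (-α)) := by
  obtain ⟨B, hB⟩ := exists_forall_abs_mul_rpow_le hp
  obtain ⟨D, hD⟩ := (Metric.isBounded_range_of_tendsto _ hq).exists_norm_le
  have hB0 : 0 ≤ B := (by positivity : (0 : ℝ) ≤ _).trans (hB 0)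
  have hD0 : 0 ≤ D := (norm_nonneg _).trans (hD _ ⟨0, rfl⟩)
  have hA' : 0 < |A| := abs_pos.2 hA
  refine ⟨2 * D * B / (x * |A|), ?_⟩
  filter_upwards [eventually_gt_atTop 0, hp.abs.eventually_const_le (half_lt_self hA')]
    with n hn hpn u hu
  have hn' : (0 : ℝ) < n := by exact_mod_cast hn
  have hpow : 0 < (n : ℝ) ^ α := by positivity
  have hu0 := hu.1
  simp only [tailDensity]
  split_ifs with hk
  · set j := ⌊(n : ℝ) * u⌋₊
    have hpj : |p j| ≤ B * ((n : ℝ) ^ (-α) * (u ^ (-α) + 2 ^ (-α))) := by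
      have h := hB j
      rw [← le_div_iff₀ (by positivity), div_eq_mul_inv, ← Real.rpow_neg (by positivity)] at h
      exact h.trans (by gcongr; exact rpow_natFloor_succ_le hn hu)
    have hqk : n * |q (n - j)| ≤ D / x := by
      have h := hD _ ⟨n - j, rfl⟩
      rw [Real.norm_eq_abs, abs_mul, Nat.abs_cast] at h
      rw [le_div_iff₀ hx]
      nlinarith [mul_le_mul_of_nonneg_right hk.le (abs_nonneg (q (n - j)))]
    rw [abs_mul, abs_of_pos hpow] at hpn
    have hpn0 : 0 < |p n| := pos_of_mul_pos_left ((half_pos hA').trans_le hpn) hpow.le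
    rw [Real.norm_eq_abs, abs_div, abs_mul, abs_mul, Nat.abs_cast, div_le_iff₀ hpn0]
    calc (n : ℝ) * (|q (n - j)| * |p j|) = n * |q (n - j)| * |p j| := by ring
      _ ≤ D / x * (B * ((n : ℝ) ^ (-α) * (u ^ (-α) + 2 ^ (-α)))) := by gcongr
      _ = 2 * D * B / (x * |A|) * (u ^ (-α) + 2 ^ (-α)) * (|A| / 2 / (n : ℝ) ^ α) := by
        rw [Real.rpow_neg hn'.le]; field_simp
      _ ≤ 2 * D * B / (x * |A|) * (u ^ (-α) + 2 ^ (-α)) * |p n| := by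
        gcongr; rwa [div_le_iff₀ hpow]
  · rw [norm_zero]; positivity

theorem tendsto_tailDensity_of_lt {α κ A : ℝ} (hA : A ≠ 0)
    (hp : Tendsto (fun n : ℕ => p n * (n : ℝ) ^ α) atTop (𝓝 A))
    (hq : Tendsto (fun k : ℕ => (k : ℝ) * q k) atTop (𝓝 κ)) (hx : 0 ≤ x) {u : ℝ} (hu : 0 < u)
    (hux : u < 1 - x) :
    Tendsto (fun n => tailDensity p q x n u) atTop (𝓝 (κ / ((1 - u) * u ^ α))) := by
  have hle := natFloor_natCast_mul_le (show u ≤ 1 by linarith)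
  have hfloor : Tendsto (fun n : ℕ => ⌊(n : ℝ) * u⌋₊) atTop atTop :=
    tendsto_nat_floor_atTop.comp (tendsto_natCast_atTop_atTop.atTop_mul_const hu)
  have hj := tendsto_natFloor_natCast_mul_div hu.le
  have hxlt (n : ℕ) (hn : 0 < n) : x * n < (n - ⌊(n : ℝ) * u⌋₊ : ℕ) := by
    rw [Nat.cast_sub (hle n)]
    have : (0 : ℝ) < n := by exact_mod_cast hn
    nlinarith [Nat.floor_le (mul_nonneg n.cast_nonneg hu.le : 0 ≤ (n : ℝ) * u)]
  have hk : Tendsto (fun n : ℕ => n - ⌊(n : ℝ) * u⌋₊) atTop atTop := by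
    rw [← tendsto_natCast_atTop_iff (R := ℝ)]
    refine tendsto_atTop_mono (fun n => ?_)
      (tendsto_natCast_atTop_atTop.atTop_mul_const (show 0 < 1 - u by linarith))
    rw [Nat.cast_sub (hle n)]
    linarith [Nat.floor_le (mul_nonneg n.cast_nonneg hu.le : 0 ≤ (n : ℝ) * u)]
  have hlim := (((hq.comp hk).div (hj.const_sub 1) (by linarith)).mul ((hp.comp hfloor).div
    (hj.rpow_const (p := α) (.inl hu.ne')) (by positivity))).div hp hA
  rw [show κ / (1 - u) * (A / u ^ α) / A = κ / ((1 - u) * u ^ α) by field_simp] at hlim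
  refine hlim.congr' ?_
  filter_upwards [eventually_gt_atTop 0, hfloor.eventually_gt_atTop 0, hk.eventually_gt_atTop 0]
    with n hn hjn hkn
  simp only [tailDensity, if_pos (hxlt n hn), Function.comp_def, Pi.div_apply]
  have hsub : 1 - (⌊(n : ℝ) * u⌋₊ : ℝ) / n = ((n - ⌊(n : ℝ) * u⌋₊ : ℕ) : ℝ) / n := by
    rw [Nat.cast_sub (hle n)]; field_simp
  rw [hsub, Real.div_rpow (by positivity) (by positivity)]
  field_simp

theorem tendsto_tailDensity_of_gt {u : ℝ} (hu : u ≤ 1) (hux : 1 - x < u) :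
    Tendsto (fun n => tailDensity p q x n u) atTop (𝓝 0) := by
  refine tendsto_const_nhds.congr' ?_
  have hlarge : Tendsto (fun n : ℕ => (n : ℝ) * (u - (1 - x))) atTop atTop :=
    tendsto_natCast_atTop_atTop.atTop_mul_const (by linarith)
  filter_upwards [hlarge.eventually_ge_atTop 1] with n hn
  simp only [tailDensity]
  rw [if_neg]
  rw [Nat.cast_sub (natFloor_natCast_mul_le hu n), not_lt]
  linarith [Nat.lt_floor_add_one ((n : ℝ) * u)]

theorem tendsto_convolution_tail {α κ A : ℝ} (hα : α < 1) (hA : A ≠ 0)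
    (hp : Tendsto (fun n : ℕ => p n * (n : ℝ) ^ α) atTop (𝓝 A))
    (hq : Tendsto (fun k : ℕ => (k : ℝ) * q k) atTop (𝓝 κ)) (hx : x ∈ Ioc (0 : ℝ) 1) :
    Tendsto (fun n : ℕ =>
      (∑ k ∈ (Finset.range (n + 1)).filter (fun k : ℕ => x * n < k), q k * p (n - k)) / p n)
      atTop (𝓝 (∫ y in x..1, κ / (y * (1 - y) ^ α))) := by
  have hlim : ∫ y in x..1, κ / (y * (1 - y) ^ α) = ∫ u in (0 : ℝ)..1,
      indicator {u | u ≤ 1 - x} (fun u => κ / ((1 - u) * u ^ α)) u := by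
    rw [intervalIntegral.integral_indicator ⟨by linarith [hx.2], by linarith [hx.1]⟩]
    simpa only [sub_sub_cancel, sub_zero] using
      (intervalIntegral.integral_comp_sub_left (a := 0) (b := 1 - x)
        (fun y => κ / (y * (1 - y) ^ α)) 1).symm
  obtain ⟨C, hC⟩ := exists_norm_tailDensity_le hA hp hq hx.1
  rw [hlim]
  refine Tendsto.congr' ((eventually_gt_atTop 0).mono fun n hn => integral_tailDensity hx.1.le hn)
    (intervalIntegral.tendsto_integral_filter_of_dominated_convergence
      (fun u => C * (u ^ (-α) + 2 ^ (-α)))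
      (.of_forall fun n => (measurable_tailDensity n).aestronglyMeasurable)
      (hC.mono fun n hn => .of_forall fun u hu => hn u (uIoc_of_le (zero_le_one' ℝ) ▸ hu))
      (((intervalIntegral.intervalIntegrable_rpow' (by linarith)).add
        intervalIntegrable_const).const_mul C) ?_)
  filter_upwards [Measure.ae_ne volume (1 - x)] with u hne hu
  rw [uIoc_of_le zero_le_one] at hu
  rcases lt_or_gt_of_ne hne with hlt | hgt
  · rw [indicator_of_mem (show u ∈ {u | u ≤ 1 - x} from hlt.le)]
    exact tendsto_tailDensity_of_lt hA hp hq hx.1.le hu.1 hlt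
  · rw [indicator_of_notMem (show u ∉ {u | u ≤ 1 - x} from not_le.2 hgt)]
    exact tendsto_tailDensity_of_gt hu.2 hgt

end TailDensity

/-! ### Components of a finite graph -/

section Components

variable {V : Type*}

theorem mem_of_reachable {G : SimpleGraph V} {S : Set V}
    (hS : ∀ a b, G.Adj a b → a ∈ S → b ∈ S) {a b : V} (hab : G.Reachable a b) (ha : a ∈ S) :
    b ∈ S := by
  obtain ⟨w⟩ := hab
  induction w with
  | nil => exact ha
  | cons h _ ih => exact ih (hS _ _ h ha)

theorem lt_largestComponent_iff [Finite V] {G : SimpleGraph V} {t : ℝ} (ht : 0 ≤ t) :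
    t < largestComponent G ↔ ∃ c : G.ConnectedComponent, t < c.supp.ncard := by
  constructor
  · intro h
    rcases isEmpty_or_nonempty G.ConnectedComponent with _ | _
    · rw [largestComponent, ciSup_of_empty] at h
      exact absurd h (by simpa using ht)
    · obtain ⟨c, hc⟩ :=
        exists_eq_ciSup_of_finite (f := fun c : G.ConnectedComponent => c.supp.ncard)
      exact ⟨c, by rwa [largestComponent, ← hc] at h⟩
  · rintro ⟨c, hc⟩
    refine hc.trans_le (Nat.cast_le.2 ?_)
    exact le_ciSup (f := fun c : G.ConnectedComponent => c.supp.ncard)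
      (Set.finite_range _).bddAbove c

variable [Fintype V] {G : SimpleGraph V}

theorem sum_ncard_supp_connectedComponent (G : SimpleGraph V) [Fintype G.ConnectedComponent] :
    ∑ c : G.ConnectedComponent, c.supp.ncard = Fintype.card V := by
  classical
  rw [← Finset.card_univ, Finset.card_eq_sum_card_fiberwise (f := G.connectedComponentMk)
    (t := Finset.univ) (by simp)]
  refine Finset.sum_congr rfl fun c _ => ?_
  rw [Set.ncard_eq_toFinset_card']
  congr 1
  ext v
  simp

theorem eq_of_card_lt_ncard_supp_add {c d : G.ConnectedComponent}
    (h : Fintype.card V < c.supp.ncard + d.supp.ncard) : c = d := by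
  by_contra hne
  have hdisj : Disjoint c.supp d.supp :=
    SimpleGraph.pairwise_disjoint_supp_connectedComponent G hne
  rw [← Set.ncard_union_eq hdisj (Set.toFinite _) (Set.toFinite _)] at h
  exact h.not_ge ((Set.ncard_le_card _).trans_eq Nat.card_eq_fintype_card)

open Classical in
theorem sum_ite_lt_ncard_supp [Fintype G.ConnectedComponent] {t : ℝ}
    (ht : (Fintype.card V : ℝ) ≤ 2 * t) :
    (∑ c : G.ConnectedComponent, if t < c.supp.ncard then 1 else 0) =
      if t < largestComponent G then 1 else 0 := by
  have ht₀ : 0 ≤ t := by linarith [(Fintype.card V).cast_nonneg (α := ℝ)]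
  split_ifs with h
  all_goals rw [lt_largestComponent_iff ht₀] at h
  · obtain ⟨c, hc⟩ := h
    rw [Fintype.sum_eq_single c, if_pos hc]
    refine fun d hdc => if_neg fun hd => hdc (eq_of_card_lt_ncard_supp_add ?_)
    exact_mod_cast (by linarith : (Fintype.card V : ℝ) < d.supp.ncard + c.supp.ncard)
  · push Not at h
    simp [fun c => (h c).not_gt]

end Components

/-! ### Decomposable classes of labeled structures -/

/-- A class of labeled structures, encoded as a property of binary relations; the components of a
structure are those of the simple graph `SimpleGraph.fromRel r` underlying its relation `r`. -/
abbrev RelationClass : Type 1 := ∀ V : Type, (V → V → Prop) → Prop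

namespace RelationClass

variable {P Q : RelationClass}

/-- A class that is invariant under relabeling and that can be tested separately on the two parts
of a partition not crossed by the relation. -/
structure IsDecomposable (P : RelationClass) : Prop where
  congr : ∀ {V W : Type} (e : V ≃ W) (r : W → W → Prop), P W r → P V (fun a b => r (e a) (e b))
  split : ∀ {V : Type} (S : Set V) (r : V → V → Prop), (∀ a b, r a b → (a ∈ S ↔ b ∈ S)) →
    (P V r ↔ P S (fun a b => r a b) ∧ P ↥Sᶜ (fun a b => r a b))

/-- The number of structures of the class on `n` labeled points. -/
noncomputable def totalCount (P : RelationClass) (n : ℕ) : ℕ :=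
  Nat.card {r : Fin n → Fin n → Prop // P _ r}

/-- The number of connected structures of the class on `n` labeled points. -/
noncomputable def connectedCount (P : RelationClass) (n : ℕ) : ℕ :=
  Nat.card {r : Fin n → Fin n → Prop // P _ r ∧ (SimpleGraph.fromRel r).Connected}

theorem IsDecomposable.congr_iff (hP : P.IsDecomposable) {V W : Type} (e : V ≃ W)
    (r : W → W → Prop) : P W r ↔ P V (fun a b => r (e a) (e b)) := by
  refine ⟨hP.congr e r, fun h => ?_⟩
  simpa using hP.congr e.symm _ h

theorem IsDecomposable.and (hP : P.IsDecomposable) (hQ : Q.IsDecomposable) :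
    IsDecomposable fun V r => P V r ∧ Q V r where
  congr e r h := ⟨hP.congr e r h.1, hQ.congr e r h.2⟩
  split S r h := by
    rw [hP.split S r h, hQ.split S r h]
    tauto

/-- `S` is the vertex set of a component of the graph underlying `r`. -/
def IsComponent {V : Type} (r : V → V → Prop) (S : Set V) : Prop :=
  ∃ c : (SimpleGraph.fromRel r).ConnectedComponent, c.supp = S

theorem fromRel_restrict {V : Type} (r : V → V → Prop) (S : Set V) :
    SimpleGraph.fromRel (fun a b : S => r a b) = (SimpleGraph.fromRel r).induce S := by
  ext a b
  simp [Subtype.ext_iff]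

theorem fromRel_connected_congr {V W : Type} (e : V ≃ W) (r : W → W → Prop) :
    (SimpleGraph.fromRel fun a b => r (e a) (e b)).Connected ↔
      (SimpleGraph.fromRel r).Connected :=
  SimpleGraph.Iso.connected_iff ⟨e, by simp⟩

theorem IsComponent.mem_iff_mem {V : Type} {r : V → V → Prop} {S : Set V} (h : IsComponent r S)
    (a b : V) (hab : r a b) : a ∈ S ↔ b ∈ S := by
  obtain ⟨c, rfl⟩ := h
  rcases eq_or_ne a b with rfl | hne
  · rfl
  · exact c.mem_supp_congr_adj (by simp [hne, hab])

theorem isComponent_iff {V : Type} (r : V → V → Prop) (S : Set V) :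
    IsComponent r S ↔ (∀ a b, r a b → (a ∈ S ↔ b ∈ S)) ∧
      (SimpleGraph.fromRel fun a b : S => r a b).Connected := by
  rw [fromRel_restrict]
  refine ⟨fun h => ⟨h.mem_iff_mem, ?_⟩, fun ⟨hclosed, hconn⟩ => ?_⟩
  · obtain ⟨c, rfl⟩ := h
    exact c.connected_toSimpleGraph
  · obtain ⟨a⟩ := hconn.nonempty
    refine ⟨(SimpleGraph.fromRel r).connectedComponentMk a, ?_⟩
    ext b
    rw [SimpleGraph.ConnectedComponent.mem_supp_iff, SimpleGraph.ConnectedComponent.eq]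
    refine ⟨fun h => mem_of_reachable (fun u v huv hu => ?_) h.symm a.2, fun hb => ?_⟩
    · rcases ((SimpleGraph.fromRel_adj r u v).1 huv).2 with h | h
      · exact (hclosed _ _ h).1 hu
      · exact (hclosed _ _ h).2 hu
    · exact (hconn.preconnected ⟨b, hb⟩ a).map (SimpleGraph.Embedding.induce S).toHom

/-- The relation on `V` that restricts to `r` on `S` and to `s` on the complement of `S`; it
reassembles a structure from one component and the rest. -/
def glue {V : Type} (S : Set V) (r : S → S → Prop) (s : ↥Sᶜ → ↥Sᶜ → Prop) (a b : V) : Prop :=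
  (∃ (ha : a ∈ S) (hb : b ∈ S), r ⟨a, ha⟩ ⟨b, hb⟩) ∨
    ∃ (ha : a ∈ Sᶜ) (hb : b ∈ Sᶜ), s ⟨a, ha⟩ ⟨b, hb⟩

section Glue

variable {V : Type} (S : Set V) (r : S → S → Prop) (s : ↥Sᶜ → ↥Sᶜ → Prop)

theorem glue_restrict_left : (fun a b : S => glue S r s a b) = r := by
  ext a b
  simp [glue]

theorem glue_restrict_right : (fun a b : ↥Sᶜ => glue S r s a b) = s := by
  ext ⟨a, ha⟩ ⟨b, hb⟩
  simp only [mem_compl_iff] at ha hb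
  simp [glue, ha, hb]

theorem mem_iff_mem_of_glue (a b : V) (h : glue S r s a b) : a ∈ S ↔ b ∈ S := by
  rcases h with ⟨ha, hb, _⟩ | ⟨ha, hb, _⟩
  · exact iff_of_true ha hb
  · exact iff_of_false ha hb

theorem glue_restrict_restrict (r : V → V → Prop) (h : ∀ a b, r a b → (a ∈ S ↔ b ∈ S)) :
    glue S (fun a b : S => r a b) (fun a b : ↥Sᶜ => r a b) = r := by
  ext a b
  simp only [glue, mem_compl_iff, exists_prop]
  have := h a b
  tauto

end Glue

/-- A structure of the class with component `S` amounts to a connected one on `S` together with an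
arbitrary one on the complement. -/
def componentEquiv (hP : P.IsDecomposable) {V : Type} (S : Set V) :
    {r : V → V → Prop // P V r ∧ IsComponent r S} ≃
      {r : S → S → Prop // P S r ∧ (SimpleGraph.fromRel r).Connected} ×
        {r : ↥Sᶜ → ↥Sᶜ → Prop // P ↥Sᶜ r} where
  toFun r := (⟨fun a b => r.1 a b, ((hP.split S r.1 r.2.2.mem_iff_mem).1 r.2.1).1,
      ((isComponent_iff r.1 S).1 r.2.2).2⟩,
    ⟨fun a b => r.1 a b, ((hP.split S r.1 r.2.2.mem_iff_mem).1 r.2.1).2⟩)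
  invFun x := ⟨glue S x.1.1 x.2.1, by
      rw [hP.split S _ (mem_iff_mem_of_glue S _ _), glue_restrict_left, glue_restrict_right]
      exact ⟨x.1.2.1, x.2.2⟩, by
      rw [isComponent_iff, glue_restrict_left]
      exact ⟨mem_iff_mem_of_glue S _ _, x.1.2.2⟩⟩
  left_inv r := Subtype.ext (glue_restrict_restrict S r.1 r.2.2.mem_iff_mem)
  right_inv x := Prod.ext (Subtype.ext (glue_restrict_left S _ _))
    (Subtype.ext (glue_restrict_right S _ _))

theorem IsDecomposable.card_eq_totalCount (hP : P.IsDecomposable) {V : Type} {n : ℕ}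
    (e : Fin n ≃ V) : Nat.card {r : V → V → Prop // P V r} = P.totalCount n := by
  refine Nat.card_congr (Equiv.subtypeEquiv
    (e.symm.arrowCongr (e.symm.arrowCongr (Equiv.refl Prop))) fun r => ?_)
  rw [hP.congr_iff e]
  rfl

theorem IsDecomposable.card_eq_connectedCount (hP : P.IsDecomposable) {V : Type} {n : ℕ}
    (e : Fin n ≃ V) :
    Nat.card {r : V → V → Prop // P V r ∧ (SimpleGraph.fromRel r).Connected} =
      P.connectedCount n := by
  refine Nat.card_congr (Equiv.subtypeEquiv
    (e.symm.arrowCongr (e.symm.arrowCongr (Equiv.refl Prop))) fun r => ?_)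
  rw [hP.congr_iff e, ← fromRel_connected_congr e]
  rfl

theorem IsDecomposable.card_isComponent (hP : P.IsDecomposable) {n : ℕ} (S : Finset (Fin n)) :
    Nat.card {r : Fin n → Fin n → Prop // P _ r ∧ IsComponent r (S : Set (Fin n))} =
      P.connectedCount S.card * P.totalCount (n - S.card) := by
  classical
  rw [Nat.card_congr (componentEquiv hP (S : Set (Fin n))), Nat.card_prod]
  congr 1
  · exact hP.card_eq_connectedCount (Fintype.equivFinOfCardEq (by simp)).symm
  · refine hP.card_eq_totalCount (Fintype.equivFinOfCardEq ?_).symm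
    rw [Fintype.card_compl_set]
    simp

open Classical in
theorem sum_connectedComponent_eq_sum_isComponent {V : Type} [Fintype V] (r : V → V → Prop)
    [Fintype (SimpleGraph.fromRel r).ConnectedComponent] (w : ℕ → ℕ) :
    ∑ c : (SimpleGraph.fromRel r).ConnectedComponent, w c.supp.ncard =
      ∑ S : Finset V, if IsComponent r S then w S.card else 0 := by
  rw [← Finset.sum_filter]
  refine Finset.sum_bij (fun c _ => c.supp.toFinset) (fun c _ => ?_) (fun c _ d _ h => ?_)
    (fun S hS => ?_) (fun c _ => ?_)
  · simpa using ⟨c, rfl⟩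
  · exact SimpleGraph.ConnectedComponent.supp_injective (Set.toFinset_inj.1 h)
  · obtain ⟨c, hc⟩ := (Finset.mem_filter.1 hS).2
    exact ⟨c, Finset.mem_univ c, by simp [hc]⟩
  · rw [Set.ncard_eq_toFinset_card']

open Classical in
theorem IsDecomposable.sum_connectedComponent (hP : P.IsDecomposable) (n : ℕ) (w : ℕ → ℕ) :
    ∑ r : {r : Fin n → Fin n → Prop // P _ r},
        ∑ c : (SimpleGraph.fromRel r.1).ConnectedComponent, w c.supp.ncard =
      ∑ k ∈ Finset.range (n + 1),
        n.choose k * (w k * (P.connectedCount k * P.totalCount (n - k))) := by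
  have hrelations (S : Finset (Fin n)) : ∑ r : {r : Fin n → Fin n → Prop // P _ r},
      (if IsComponent r.1 (S : Set (Fin n)) then w S.card else 0) =
      w S.card * (P.connectedCount S.card * P.totalCount (n - S.card)) := by
    rw [← hP.card_isComponent S, ← Finset.sum_filter, Finset.sum_const, smul_eq_mul, mul_comm,
      ← Fintype.card_subtype, ← Nat.card_eq_fintype_card]
    exact congrArg _ (Nat.card_congr (Equiv.subtypeSubtypeEquivSubtypeInter
      (P (Fin n)) (fun r => IsComponent r (S : Set (Fin n)))))
  rw [Finset.sum_congr rfl fun r _ => sum_connectedComponent_eq_sum_isComponent r.1 w,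
    Finset.sum_comm, Finset.sum_congr rfl fun S _ => hrelations S]
  simpa using Finset.sum_powerset_apply_card
    (fun k => w k * (P.connectedCount k * P.totalCount (n - k)))
    (x := (Finset.univ : Finset (Fin n)))

theorem IsDecomposable.mul_totalCount (hP : P.IsDecomposable) (n : ℕ) :
    n * P.totalCount n = ∑ k ∈ Finset.range (n + 1),
      n.choose k * (k * (P.connectedCount k * P.totalCount (n - k))) := by
  classical
  have h := hP.sum_connectedComponent n fun k => k
  simp only [sum_ncard_supp_connectedComponent, Fintype.card_fin] at h
  rw [← h, Finset.sum_const, smul_eq_mul, mul_comm, Finset.card_univ, ← Nat.card_eq_fintype_card,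
    totalCount]

theorem IsDecomposable.card_lt_largestComponent (hP : P.IsDecomposable) (n : ℕ) {t : ℝ}
    (ht : n ≤ 2 * t) :
    Nat.card {r : {r : Fin n → Fin n → Prop // P _ r} //
        t < largestComponent (SimpleGraph.fromRel r.1)} =
      ∑ k ∈ Finset.range (n + 1) with t < ((k : ℕ) : ℝ),
        n.choose k * (P.connectedCount k * P.totalCount (n - k)) := by
  classical
  have ht' : (Fintype.card (Fin n) : ℝ) ≤ 2 * t := by simpa using ht
  have h := hP.sum_connectedComponent n fun k => if t < k then 1 else 0
  simp only [sum_ite_lt_ncard_supp ht'] at h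
  rw [← Finset.sum_filter, Finset.sum_const, smul_eq_mul, mul_one, ← Fintype.card_subtype,
    ← Nat.card_eq_fintype_card] at h
  simp only [h, Finset.sum_filter, ite_mul, one_mul, zero_mul, mul_ite, mul_zero]

end RelationClass

/-- The exponential generating function of a sequence counting labeled structures. -/
noncomputable def egf (a : ℕ → ℕ) : PowerSeries ℝ := PowerSeries.mk fun n => a n / n.factorial

theorem coeff_derivative_egf (a : ℕ → ℕ) (n : ℕ) :
    PowerSeries.coeff n (PowerSeries.derivative ℝ (egf a)) =
      a (n + 1) / n.factorial := by
  rw [PowerSeries.coeff_derivative, egf, PowerSeries.coeff_mk, Nat.factorial_succ]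
  push_cast
  field_simp

namespace RelationClass

variable {P : RelationClass}

theorem IsDecomposable.derivative_egf_totalCount (hP : P.IsDecomposable) :
    PowerSeries.derivative ℝ (egf P.totalCount) =
      PowerSeries.derivative ℝ (egf P.connectedCount) * egf P.totalCount := by
  ext n
  have h : (((n + 1) * P.totalCount (n + 1) : ℕ) : ℝ) = _ :=
    congrArg _ (hP.mul_totalCount (n + 1))
  rw [Finset.sum_range_succ', zero_mul, mul_zero, add_zero] at h
  rw [PowerSeries.coeff_mul, Finset.Nat.sum_antidiagonal_eq_sum_range_succ_mk,
    coeff_derivative_egf, ← mul_right_inj' (show ((n + 1).factorial : ℝ) ≠ 0 by positivity),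
    Finset.mul_sum]
  trans (((n + 1) * P.totalCount (n + 1) : ℕ) : ℝ)
  · rw [Nat.factorial_succ]
    push_cast
    field_simp
  · rw [h]
    push_cast
    refine Finset.sum_congr rfl fun k hk => ?_
    have hk : k ≤ n := Nat.lt_succ_iff.1 (Finset.mem_range.1 hk)
    rw [coeff_derivative_egf, egf, PowerSeries.coeff_mk,
      ← Nat.choose_mul_factorial_mul_factorial (Nat.succ_le_succ hk), Nat.succ_sub_succ,
      Nat.factorial_succ]
    push_cast
    field_simp

theorem IsDecomposable.uniformProb_lt_largestComponent (hP : P.IsDecomposable) {ρ : ℝ}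
    (hρ : ρ ≠ 0) (n : ℕ) {t : ℝ} (ht : n ≤ 2 * t) :
    uniformProb (fun r : {r : Fin n → Fin n → Prop // P _ r} =>
        t < largestComponent (SimpleGraph.fromRel r.1)) =
      (∑ k ∈ Finset.range (n + 1) with t < ((k : ℕ) : ℝ),
        P.connectedCount k / (k.factorial * ρ ^ k) *
          (P.totalCount (n - k) / ((n - k).factorial * ρ ^ (n - k)))) /
        (P.totalCount n / (n.factorial * ρ ^ n)) := by
  rw [uniformProb, hP.card_lt_largestComponent n ht, ← totalCount, div_div_eq_mul_div,
    Nat.cast_sum, Finset.sum_mul]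
  congr 1
  refine Finset.sum_congr rfl fun k hk => ?_
  have hk : k ≤ n := Nat.lt_succ_iff.1 (Finset.mem_range.1 (Finset.mem_filter.1 hk).1)
  rw [← Nat.choose_mul_factorial_mul_factorial hk, ← pow_mul_pow_sub ρ hk]
  push_cast
  field_simp

theorem IsDecomposable.tendsto_uniformProb_lt_largestComponent (hP : P.IsDecomposable)
    {α κ ρ A : ℝ} (hα : α < 1) (hρ : ρ ≠ 0) (hA : A ≠ 0)
    (htotal : Tendsto (fun n : ℕ => P.totalCount n / (n.factorial * ρ ^ n) * (n : ℝ) ^ α) atTop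
      (𝓝 A))
    (hconnected : Tendsto (fun k : ℕ => (k : ℝ) * (P.connectedCount k / (k.factorial * ρ ^ k)))
      atTop (𝓝 κ)) {x : ℝ} (hx : x ∈ Icc (1 / 2) 1) :
    Tendsto (fun n : ℕ => uniformProb (fun r : {r : Fin n → Fin n → Prop // P _ r} =>
        x * n < largestComponent (SimpleGraph.fromRel r.1))) atTop
      (𝓝 (∫ y in x..1, κ / (y * (1 - y) ^ α))) := by
  refine (tendsto_convolution_tail hα hA htotal hconnected
    ⟨by linarith [hx.1], hx.2⟩).congr fun n => ?_
  rw [hP.uniformProb_lt_largestComponent hρ]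
  nlinarith [hx.1, n.cast_nonneg (α := ℝ)]

end RelationClass

/-! ### Mappings -/

namespace RelationClass

/-- The class of relations in which every element is related to exactly `d` elements. -/
def HasOutDegree (d : ℕ) : RelationClass := fun _ r => ∀ a, {b | r a b}.ncard = d

theorem ncard_restrict {V : Type} (S : Set V) {r : V → V → Prop}
    (h : ∀ a b, r a b → (a ∈ S ↔ b ∈ S)) (a : S) :
    {b : S | r a b}.ncard = {b : V | r a b}.ncard := by
  rw [← Set.ncard_image_of_injective _ Subtype.val_injective]
  congr 1
  ext b
  simpa using (h a b · |>.1 a.2)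

theorem isDecomposable_hasOutDegree (d : ℕ) : (HasOutDegree d).IsDecomposable where
  congr e r h a := by
    rw [← h (e a), ← Set.ncard_image_of_injective _ e.injective]
    congr 1
    exact e.image_preimage {b | r (e a) b}
  split S r h := by
    have h' : ∀ a b, r a b → (a ∈ Sᶜ ↔ b ∈ Sᶜ) := fun a b hab => not_congr (h a b hab)
    refine ⟨fun hr => ⟨fun a => ?_, fun a => ?_⟩, fun hr a => ?_⟩
    · rw [ncard_restrict S h, hr]
    · rw [ncard_restrict Sᶜ h', hr]
    · by_cases ha : a ∈ S
      · rw [← ncard_restrict S h ⟨a, ha⟩, hr.1]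
      · rw [← ncard_restrict Sᶜ h' ⟨a, ha⟩, hr.2]

/-- A map `f`, viewed as the relation `f a = b`, which has out-degree one. -/
noncomputable def mapEquiv (V : Type) : (V → V) ≃ {r : V → V → Prop // HasOutDegree 1 V r} :=
  Equiv.ofBijective (fun f => ⟨fun a b => f a = b, fun a => by simp⟩) <| by
    constructor
    · intro f g hfg
      funext a
      simpa using congrFun (congrFun (congrArg Subtype.val hfg) a) (g a)
    · rintro ⟨r, hr⟩
      choose f hf using fun a => Set.ncard_eq_one.1 (hr a)
      refine ⟨f, Subtype.ext ?_⟩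
      ext a b
      exact eq_comm.trans (Set.ext_iff.1 (hf a) b).symm

theorem totalCount_hasOutDegree_one (n : ℕ) : (HasOutDegree 1).totalCount n = n ^ n := by
  rw [totalCount, ← Nat.card_congr (mapEquiv (Fin n))]
  simp

end RelationClass

section Abel

variable {K : Type*} [Field K] [CharZero K]

theorem add_pow_div_factorial (a b : K) (n : ℕ) :
    (a + b) ^ n / n.factorial = ∑ i ∈ Finset.range (n + 1),
      a ^ i / i.factorial * (b ^ (n - i) / (n - i).factorial) := by
  rw [add_pow, Finset.sum_div]
  refine Finset.sum_congr rfl fun i hi => ?_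
  rw [Nat.cast_choose K (Finset.mem_range_succ_iff.1 hi)]
  field_simp [Nat.factorial_ne_zero]

theorem sum_neg_one_pow_mul_add_pow (x : K) (n : ℕ) :
    ∑ m ∈ Finset.range (n + 1),
      (-1) ^ (n - m) * (x + m) ^ n / (m.factorial * (n - m).factorial) = 1 := by
  have hne : (n.factorial : K) ≠ 0 := Nat.cast_ne_zero.2 n.factorial_ne_zero
  have hdiff := congrFun (fwdDiff_iter_eq_factorial (R := K) (n := n)) x
  rw [fwdDiff_iter_eq_sum_shift, Pi.natCast_apply, ← div_eq_one_iff_eq hne,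
    Finset.sum_div] at hdiff
  refine Eq.trans (Finset.sum_congr rfl fun m hm => ?_) hdiff
  simp only [zsmul_eq_mul, nsmul_eq_mul, mul_one, Int.cast_mul, Int.cast_pow, Int.cast_neg,
    Int.cast_one, Int.cast_natCast]
  rw [Nat.cast_choose K (Finset.mem_range_succ_iff.1 hm)]
  field_simp [Nat.factorial_ne_zero]

theorem abel_binomial (x y : K) (n : ℕ) :
    ∑ m ∈ Finset.range (n + 1), (x + m) ^ m / m.factorial *
        ((y + (n - m : ℕ)) ^ (n - m) / (n - m).factorial) =
      ∑ i ∈ Finset.range (n + 1), (x + y + n) ^ i / i.factorial := by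
  have hexpand : ∀ m ∈ Finset.range (n + 1), (x + m) ^ m / m.factorial *
      ((y + (n - m : ℕ)) ^ (n - m) / (n - m).factorial) =
      ∑ i ∈ Finset.range (n - m + 1), (x + y + n) ^ i / i.factorial *
        ((-1) ^ (n - i - m) * (x + m) ^ (n - i) / (m.factorial * (n - i - m).factorial)) := by
    intro m hm
    have hmn : m ≤ n := Finset.mem_range_succ_iff.1 hm
    have hy : y + (n - m : ℕ) = (x + y + n) + -(x + m) := by
      rw [Nat.cast_sub hmn]; ring
    rw [hy, add_pow_div_factorial (x + y + n), Finset.mul_sum]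
    refine Finset.sum_congr rfl fun i hi => ?_
    have hi : i ≤ n - m := Finset.mem_range_succ_iff.1 hi
    rw [neg_pow (x + m), Nat.sub_right_comm n m i, ← pow_mul_pow_sub (x + (m : K))
      (show m ≤ n - i by omega)]
    field_simp
  rw [Finset.sum_congr rfl hexpand, Finset.sum_comm' (t' := Finset.range (n + 1))
    (s' := fun i => Finset.range (n - i + 1)) (by intro m i; simp only [Finset.mem_range]; omega)]
  refine Finset.sum_congr rfl fun i _ => ?_
  rw [← Finset.mul_sum, sum_neg_one_pow_mul_add_pow, mul_one]

theorem sum_sub_mul_pow_div_factorial (z : K) (n : ℕ) :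
    ∑ i ∈ Finset.range n, (z - i) * (z ^ i / i.factorial) = n * (z ^ n / n.factorial) := by
  induction n with
  | zero => simp
  | succ n ih =>
    rw [Finset.sum_range_succ, ih, Nat.factorial_succ]
    push_cast
    field_simp [Nat.factorial_ne_zero]
    ring

theorem sum_sum_triangle_reflect {M : Type*} [AddCommMonoid M] (F : ℕ → ℕ → M) (n : ℕ) :
    ∑ k ∈ Finset.range (n + 1), ∑ m ∈ Finset.range (k + 1), F k m =
      ∑ l ∈ Finset.range (n + 1), ∑ m ∈ Finset.range (l + 1), F (n - l + m) m := by
  rw [Finset.sum_sigma', Finset.sum_sigma']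
  refine Finset.sum_nbij' (fun x => ⟨n - x.1 + x.2, x.2⟩) (fun x => ⟨n - x.1 + x.2, x.2⟩)
    ?_ ?_ ?_ ?_ ?_ <;> rintro ⟨k, m⟩ h <;> simp only [Finset.mem_sigma, Finset.mem_range] at h ⊢
  · omega
  · omega
  all_goals rw [show n - (n - k + m) + m = k by omega]

theorem sum_sum_pow_div_factorial_mul (n : ℕ) :
    ∑ k ∈ Finset.range (n + 1), (∑ m ∈ Finset.range (k + 1), ((k + 1 : ℕ) : K) ^ m / m.factorial) *
        (((n - k : ℕ) : K) ^ (n - k) / (n - k).factorial) =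
      (n + 1 : ℕ) ^ (n + 1) / n.factorial := by
  have habel : ∀ l ∈ Finset.range (n + 1), ∑ m ∈ Finset.range (l + 1),
        ((n - l + m + 1 : ℕ) : K) ^ m / m.factorial *
          (((n - (n - l + m) : ℕ) : K) ^ (n - (n - l + m)) / (n - (n - l + m)).factorial) =
      ∑ i ∈ Finset.range (l + 1), ((n + 1 : ℕ) : K) ^ i / i.factorial := by
    intro l hl
    have hl : l ≤ n := Finset.mem_range_succ_iff.1 hl
    have h := abel_binomial ((n - l + 1 : ℕ) : K) 0 l
    simp only [zero_add, add_zero, ← Nat.cast_add, show n - l + 1 + l = n + 1 by omega] at h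
    rw [← h]
    refine Finset.sum_congr rfl fun m hm => ?_
    have hm : m ≤ l := Finset.mem_range_succ_iff.1 hm
    rw [show n - (n - l + m) = l - m by omega, Nat.add_right_comm]
  have hweighted := sum_sub_mul_pow_div_factorial ((n + 1 : ℕ) : K) (n + 1)
  rw [Nat.factorial_succ, Nat.cast_mul, mul_div_assoc', mul_div_mul_left _ _
    (Nat.cast_ne_zero.2 n.succ_ne_zero)] at hweighted
  simp_rw [Finset.sum_mul]
  rw [sum_sum_triangle_reflect, Finset.sum_congr rfl habel, ← hweighted,
    Finset.sum_comm' (t' := Finset.range (n + 1)) (s' := fun i => Finset.Ico i (n + 1))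
      (by intro l i; simp only [Finset.mem_range, Finset.mem_Ico]; omega)]
  refine Finset.sum_congr rfl fun i hi => ?_
  rw [Finset.sum_const, Nat.card_Ico, nsmul_eq_mul, Nat.cast_sub (Finset.mem_range.1 hi).le]

end Abel

namespace RelationClass

theorem connectedCount_hasOutDegree_one (k : ℕ) :
    ((HasOutDegree 1).connectedCount (k + 1) : ℝ) / k.factorial =
      ∑ m ∈ Finset.range (k + 1), ((k + 1 : ℕ) : ℝ) ^ m / m.factorial := by
  have hne : egf (HasOutDegree 1).totalCount ≠ 0 := fun h => by
    simpa [egf, totalCount_hasOutDegree_one] using congrArg (PowerSeries.coeff 0) h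
  have heq : PowerSeries.derivative ℝ (egf (HasOutDegree 1).connectedCount) =
      PowerSeries.mk fun k =>
        ∑ m ∈ Finset.range (k + 1), ((k + 1 : ℕ) : ℝ) ^ m / m.factorial := by
    refine mul_right_cancel₀ hne ?_
    rw [← (isDecomposable_hasOutDegree 1).derivative_egf_totalCount]
    ext n
    rw [coeff_derivative_egf, PowerSeries.coeff_mul,
      Finset.Nat.sum_antidiagonal_eq_sum_range_succ_mk]
    simp only [egf, PowerSeries.coeff_mk, totalCount_hasOutDegree_one, Nat.cast_pow]
    exact (sum_sum_pow_div_factorial_mul n).symm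
  rw [← coeff_derivative_egf, heq, PowerSeries.coeff_mk]

end RelationClass

section Poisson

open ProbabilityTheory Asymptotics Complex
open scoped NNReal

theorem gaussianReal_real_Iio_zero : (gaussianReal 0 1).real (Iio 0) = 1 / 2 := by
  have := nullSingletonClass_gaussianReal (μ := 0) one_ne_zero
  have hsymm : (gaussianReal 0 1).real (Ici 0) = (gaussianReal 0 1).real (Iio 0) := by
    rw [← measureReal_congr Iio_ae_eq_Iic.symm]
    conv_rhs => rw [← neg_zero, ← gaussianReal_map_neg]
    rw [map_measureReal_apply measurable_neg measurableSet_Iic]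
    simp
  have htotal :=
    probReal_add_probReal_compl (μ := gaussianReal 0 1) (measurableSet_Iio (a := (0 : ℝ)))
  rw [compl_Iio, hsymm] at htotal
  linarith

theorem charFun_map_standardize_poissonMeasure (r : ℝ≥0) (t : ℝ) :
    charFun (((poissonMeasure r).map ((↑) : ℕ → ℝ)).map fun x => (√r)⁻¹ * (x + -r)) t =
      exp (r * (exp ((√r : ℝ)⁻¹ * t * I) - 1 - (√r : ℝ)⁻¹ * t * I)) := by
  rw [charFun_map_mul_comp (by fun_prop), charFun_map_add_const,
    charFun_map_cast_poissonMeasure, ← exp_add, Real.inner_apply]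
  push_cast
  ring_nf

theorem tendsto_mul_exp_sub_one_sub (t : ℝ) :
    Tendsto (fun r : ℝ => r * (exp ((√r : ℝ)⁻¹ * t * I) - 1 - (√r : ℝ)⁻¹ * t * I)) atTop
      (𝓝 (-t ^ 2 / 2)) := by
  have hzero : Tendsto (fun r : ℝ => ((√r : ℝ)⁻¹ * t * I : ℂ)) atTop (𝓝 0) := by
    have h := ((tendsto_inv_atTop_zero.comp Real.tendsto_sqrt_atTop).mul_const t).ofReal.mul_const I
    simpa using h
  have hsq : ∀ᶠ r : ℝ in atTop, (r : ℂ) * ((√r : ℝ)⁻¹ * t * I : ℂ) ^ 2 = -t ^ 2 := by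
    filter_upwards [eventually_gt_atTop 0] with r hr
    have hr' : (r : ℂ) ≠ 0 := ofReal_ne_zero.2 hr.ne'
    rw [mul_pow, mul_pow, I_sq, ← ofReal_pow, inv_pow, Real.sq_sqrt hr.le, ofReal_inv]
    field_simp
  have hremainder : Tendsto (fun r : ℝ => (r : ℂ) * (exp ((√r : ℝ)⁻¹ * t * I) -
      ∑ i ∈ Finset.range 3, ((√r : ℝ)⁻¹ * t * I) ^ i / i.factorial)) atTop (𝓝 0) := by
    rw [← isLittleO_one_iff ℝ]
    refine ((isBigO_refl _ _).mul_isLittleO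
      ((exp_sub_sum_range_succ_isLittleO_pow 2).comp_tendsto hzero)).trans_isBigO ?_
    exact (EventuallyEq.isBigO hsq).trans (isBigO_const_const _ one_ne_zero _)
  have hlim := hremainder.add_const (-t ^ 2 / 2 : ℂ)
  rw [zero_add] at hlim
  refine hlim.congr' (hsq.mono fun r hr => ?_)
  rw [← hr]
  simp only [Finset.sum_range_succ, Finset.sum_range_zero, Nat.factorial]
  push_cast
  ring

/-- The Poisson distribution of rate `r`, centred and scaled to variance one. -/
noncomputable def standardizedPoisson (r : ℝ≥0) : ProbabilityMeasure ℝ :=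
  ⟨((poissonMeasure r).map ((↑) : ℕ → ℝ)).map fun x => (√r)⁻¹ * (x + -r),
    Measure.isProbabilityMeasure_map (by fun_prop)⟩

theorem tendsto_standardizedPoisson {r : ℕ → ℝ≥0} (hr : Tendsto r atTop atTop) :
    Tendsto (fun n => standardizedPoisson (r n)) atTop
      (𝓝 ⟨gaussianReal 0 1, inferInstance⟩) := by
  refine ProbabilityMeasure.tendsto_of_tendsto_charFun fun t => ?_
  have h := (continuous_exp.tendsto _).comp ((tendsto_mul_exp_sub_one_sub t).comp
    (NNReal.tendsto_coe_atTop.2 hr))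
  simpa [standardizedPoisson, charFun_map_standardize_poissonMeasure, charFun_gaussianReal,
    Function.comp_def, neg_div] using h

theorem standardizedPoisson_Iio_zero {r : ℝ≥0} (hr : 0 < r) :
    (standardizedPoisson r (Iio 0) : ℝ) = (poissonMeasure r).real {k : ℕ | (k : ℝ) < r} := by
  have hpos : 0 < (√(r : ℝ))⁻¹ := by positivity
  change Measure.real (Measure.map _ _) (Iio 0) = _
  rw [map_measureReal_apply (by fun_prop) measurableSet_Iio,
    map_measureReal_apply (by fun_prop) (measurableSet_Iio.preimage (by fun_prop))]
  congr 1
  ext k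
  simp only [mem_preimage, mem_Iio, mem_ofPred_eq, mul_neg_iff, hpos, hpos.le.not_gt, true_and,
    false_and, or_false]
  rw [← sub_eq_add_neg, sub_neg]

theorem tendsto_poissonMeasure_real_lt_rate {r : ℕ → ℝ≥0} (hr : Tendsto r atTop atTop) :
    Tendsto (fun n => (poissonMeasure (r n)).real {k : ℕ | (k : ℝ) < r n}) atTop (𝓝 (1 / 2)) := by
  have := nullSingletonClass_gaussianReal (μ := 0) one_ne_zero
  have h := (NNReal.continuous_coe.tendsto _).comp
    (ProbabilityMeasure.tendsto_measure_of_null_frontier_of_tendsto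
      (tendsto_standardizedPoisson hr) (E := Iio 0) (by simp))
  rw [← gaussianReal_real_Iio_zero]
  refine h.congr' ((hr.eventually_gt_atTop 0).mono fun n hn => ?_)
  exact standardizedPoisson_Iio_zero hn

theorem poissonMeasure_real_lt_rate (n : ℕ) :
    (poissonMeasure n).real {k : ℕ | (k : ℝ) < (n : ℝ≥0)} =
      Real.exp (-n) * ∑ k ∈ Finset.range n, (n : ℝ) ^ k / k.factorial := by
  rw [show {k : ℕ | (k : ℝ) < (n : ℝ≥0)} = (Finset.range n : Set ℕ) by ext; simp,
    ← sum_measureReal_singleton, Finset.mul_sum]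
  simp only [poissonMeasure_real_singleton, NNReal.coe_natCast, mul_div_assoc]

end Poisson

theorem tendsto_exp_neg_mul_sum_pow_div_factorial :
    Tendsto (fun n : ℕ => Real.exp (-n) * ∑ k ∈ Finset.range n, (n : ℝ) ^ k / k.factorial) atTop
      (𝓝 (1 / 2)) := by
  simp only [← poissonMeasure_real_lt_rate]
  exact tendsto_poissonMeasure_real_lt_rate tendsto_natCast_atTop_atTop

theorem tendsto_pow_self_div_factorial_mul_exp_pow :
    Tendsto (fun n : ℕ => (n : ℝ) ^ n / (n.factorial * Real.exp 1 ^ n) * √n) atTop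
      (𝓝 (√(2 * Real.pi))⁻¹) := by
  rw [Real.sqrt_mul zero_le_two]
  refine ((Stirling.tendsto_stirlingSeq_sqrt_pi.const_mul √2).inv₀ (by positivity)).congr'
    ((eventually_gt_atTop 0).mono fun n hn => ?_)
  have : 0 < √(n : ℝ) := Real.sqrt_pos.2 (by exact_mod_cast hn)
  rw [Stirling.stirlingSeq, Real.sqrt_mul zero_le_two, div_pow]
  field_simp

namespace RelationClass

theorem tendsto_totalCount_hasOutDegree_one :
    Tendsto (fun n : ℕ => (HasOutDegree 1).totalCount n / (n.factorial * Real.exp 1 ^ n) *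
      (n : ℝ) ^ (1 / 2 : ℝ)) atTop (𝓝 (√(2 * Real.pi))⁻¹) := by
  simpa only [totalCount_hasOutDegree_one, ← Real.sqrt_eq_rpow, Nat.cast_pow] using
    tendsto_pow_self_div_factorial_mul_exp_pow

theorem tendsto_connectedCount_hasOutDegree_one :
    Tendsto (fun k : ℕ => (k : ℝ) *
      ((HasOutDegree 1).connectedCount k / (k.factorial * Real.exp 1 ^ k))) atTop (𝓝 (1 / 2)) := by
  rw [← tendsto_add_atTop_iff_nat 1]
  refine ((tendsto_add_atTop_iff_nat 1).2 tendsto_exp_neg_mul_sum_pow_div_factorial).congr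
    fun k => ?_
  rw [← connectedCount_hasOutDegree_one, Real.exp_neg, ← Real.exp_one_pow, Nat.factorial_succ]
  push_cast
  field_simp

end RelationClass

/-! ### 2-regular graphs -/

section CyclicPermutations

variable {V : Type*}

/-- The undirected graph of the permutation `σ`: the cycles of `σ` with their orientation
forgotten. -/
def permGraph (σ : Equiv.Perm V) : SimpleGraph V :=
  SimpleGraph.fromRel fun a b => σ a = b

theorem permGraph_adj {σ : Equiv.Perm V} {a b : V} :
    (permGraph σ).Adj a b ↔ a ≠ b ∧ (σ a = b ∨ σ b = a) := by
  simp [permGraph]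

theorem permGraph_inv (σ : Equiv.Perm V) : permGraph σ⁻¹ = permGraph σ := by
  ext a b
  simp only [permGraph_adj, Equiv.Perm.inv_eq_iff_eq]
  grind

theorem neighborSet_permGraph {σ : Equiv.Perm V} (h : ∀ v, σ (σ v) ≠ v) (v : V) :
    (permGraph σ).neighborSet v = {σ v, σ⁻¹ v} := by
  have hne : ∀ v, σ v ≠ v := fun v hv => h v (by rw [hv, hv])
  ext w
  simp only [SimpleGraph.mem_neighborSet, permGraph_adj, mem_insert_iff, mem_singleton_iff,
    Equiv.Perm.eq_inv_iff_eq]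
  grind

theorem ncard_neighborSet_permGraph {σ : Equiv.Perm V} (h : ∀ v, σ (σ v) ≠ v) (v : V) :
    ((permGraph σ).neighborSet v).ncard = 2 := by
  rw [neighborSet_permGraph h, Set.ncard_pair]
  rw [Ne, Equiv.Perm.eq_inv_iff_eq]
  exact h v

theorem apply_apply_ne_of_isCycleOn_univ {σ : Equiv.Perm V} (hσ : σ.IsCycleOn univ)
    (hV : 3 ≤ Nat.card V) (v : V) : σ (σ v) ≠ v := by
  have := Nat.finite_of_card_ne_zero (show Nat.card V ≠ 0 by omega)
  have := Fintype.ofFinite V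
  rw [← Finset.coe_univ] at hσ
  intro h
  have hdvd : Finset.univ.card ∣ 2 := (hσ.pow_apply_eq (Finset.mem_univ v)).1 h
  rw [Finset.card_univ, ← Nat.card_eq_fintype_card] at hdvd
  exact absurd (Nat.le_of_dvd two_pos hdvd) (by omega)

theorem connected_permGraph [Finite V] [Nonempty V] {σ : Equiv.Perm V} (hσ : σ.IsCycleOn univ) :
    (permGraph σ).Connected := by
  have hstep : ∀ v, (permGraph σ).Reachable v (σ v) := fun v => by
    by_cases h : v = σ v
    · exact h ▸ .refl _
    · exact SimpleGraph.Adj.reachable (permGraph_adj.2 ⟨h, .inl rfl⟩)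
  refine ⟨fun v w => ?_⟩
  obtain ⟨n, rfl⟩ := hσ.exists_pow_eq' finite_univ (mem_univ v) (mem_univ w)
  induction n with
  | zero => exact .refl _
  | succ n ih =>
    rw [pow_succ']
    exact ih.trans (hstep _)

theorem eq_of_permGraph_eq_of_apply_eq [Finite V] {σ τ : Equiv.Perm V}
    (hσ : σ.IsCycleOn univ) (hσ₂ : ∀ v, σ (σ v) ≠ v) (hτ₂ : ∀ v, τ (τ v) ≠ v)
    (h : permGraph σ = permGraph τ) {v : V} (hv : σ v = τ v) : σ = τ := by
  have hall : ∀ n : ℕ, σ ((σ ^ n) v) = τ ((σ ^ n) v) := by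
    intro n
    induction n with
    | zero => exact hv
    | succ n ih =>
      have hmem : σ ((σ ^ (n + 1)) v) ∈ (permGraph τ).neighborSet ((σ ^ (n + 1)) v) := by
        rw [← h, neighborSet_permGraph hσ₂]
        exact .inl rfl
      rw [neighborSet_permGraph hτ₂] at hmem
      refine hmem.resolve_right fun hback => hσ₂ ((σ ^ n) v) ?_
      rw [mem_singleton_iff, Equiv.Perm.eq_inv_iff_eq, pow_succ', Equiv.Perm.mul_apply] at hback
      exact τ.injective (hback.trans ih)
  ext w
  obtain ⟨n, rfl⟩ := hσ.exists_pow_eq' finite_univ (mem_univ v) (mem_univ w)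
  exact hall n

theorem permGraph_eq_permGraph_iff [Finite V] (hV : 3 ≤ Nat.card V) {σ τ : Equiv.Perm V}
    (hσ : σ.IsCycleOn univ) (hτ : τ.IsCycleOn univ) :
    permGraph τ = permGraph σ ↔ τ = σ ∨ τ = σ⁻¹ := by
  constructor
  · intro h
    have hσ₂ := apply_apply_ne_of_isCycleOn_univ hσ hV
    have hτ₂ := apply_apply_ne_of_isCycleOn_univ hτ hV
    have hσ₂' := apply_apply_ne_of_isCycleOn_univ hσ.inv hV
    obtain ⟨v⟩ : Nonempty V := (Nat.card_pos_iff.1 (by omega)).1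
    have hv : τ v ∈ (permGraph σ).neighborSet v := by
      rw [← h, neighborSet_permGraph hτ₂]
      exact .inl rfl
    rw [neighborSet_permGraph hσ₂] at hv
    exact hv.imp (eq_of_permGraph_eq_of_apply_eq hτ hτ₂ hσ₂ h)
      (eq_of_permGraph_eq_of_apply_eq hτ hτ₂ hσ₂' (h.trans (permGraph_inv σ).symm))
  · rintro (rfl | rfl)
    · rfl
    · exact permGraph_inv σ

theorem exists_isCycleOn_univ_forall_adj [Finite V] {G : SimpleGraph V} (hG : G.IsCycles)
    (hconn : G.Connected) {v w : V} (hvw : G.Adj v w) :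
    ∃ σ : Equiv.Perm V, σ.IsCycleOn univ ∧ ∀ a, G.Adj a (σ a) := by
  classical
  obtain ⟨p, hp, hverts⟩ := hG.exists_cycle_toSubgraph_verts_eq_connectedComponentSupp
    (c := G.connectedComponentMk v) rfl ⟨w, hvw⟩
  have hmem : ∀ a, a ∈ p.support.tail := fun a => by
    have ha : a ∈ p.support := by
      rw [← p.mem_verts_toSubgraph, hverts]
      exact SimpleGraph.ConnectedComponent.sound (hconn.preconnected a v)
    rcases p.mem_support_iff.1 ha with rfl | h
    · exact p.end_mem_tail_support hp.not_nil
    · exact h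
  have hget : ∀ i (hi : i < p.support.tail.length), p.support.tail[i] = p.getVert (i + 1) :=
    fun i hi => by rw [List.getElem_tail, p.support_getElem_eq_getVert]
  refine ⟨p.support.tail.formPerm, ?_, fun a => ?_⟩
  · convert! hp.support_nodup.isCycleOn_formPerm using 1
    exact (eq_univ_of_forall hmem).symm
  · obtain ⟨i, hi, rfl⟩ := List.getElem_of_mem (hmem a)
    rw [List.formPerm_apply_getElem _ hp.support_nodup, hget, hget]
    have hlen : p.support.tail.length = p.length := by simp
    rcases (show i + 1 ≤ p.length by omega).lt_or_eq with h | h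
    · rw [Nat.mod_eq_of_lt (hlen ▸ h)]
      exact p.adj_getVert_succ h
    · rw [hlen, h, Nat.mod_self, p.getVert_length]
      simpa using p.adj_getVert_succ (show 0 < p.length by omega)

theorem exists_permGraph_eq [Finite V] {G : SimpleGraph V} (hV : 3 ≤ Nat.card V)
    (hG : ∀ v, (G.neighborSet v).ncard = 2) (hconn : G.Connected) :
    ∃ σ : Equiv.Perm V, σ.IsCycleOn univ ∧ permGraph σ = G := by
  obtain ⟨v⟩ := hconn.nonempty
  obtain ⟨w, hw⟩ := Set.nonempty_of_ncard_ne_zero (show (G.neighborSet v).ncard ≠ 0 by simp [hG])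
  obtain ⟨σ, hσ, hadj⟩ := exists_isCycleOn_univ_forall_adj (fun v _ => hG v) hconn hw
  refine ⟨σ, hσ, ?_⟩
  have hle : permGraph σ ≤ G := fun a b hab => by
    obtain ⟨-, rfl | rfl⟩ := permGraph_adj.1 hab
    · exact hadj a
    · exact (hadj b).symm
  ext a b
  have hN : (permGraph σ).neighborSet a = G.neighborSet a :=
    Set.eq_of_subset_of_ncard_le (fun b hb => hle hb)
      (by rw [hG, ncard_neighborSet_permGraph (apply_apply_ne_of_isCycleOn_univ hσ hV)])
  exact Set.ext_iff.1 hN b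

theorem isCycleOn_univ_iff_cycleType [Fintype V] [DecidableEq V] [Nontrivial V]
    {σ : Equiv.Perm V} : σ.IsCycleOn univ ↔ σ.cycleType = {Fintype.card V} := by
  refine ⟨fun hσ => ?_, fun hσ => ?_⟩
  · have hcycle : σ.IsCycle := Equiv.Perm.isCycle_iff_exists_isCycleOn.2
      ⟨univ, nontrivial_univ, hσ, fun _ _ => mem_univ _⟩
    have hsupport : σ.support = Finset.univ := Finset.eq_univ_of_forall fun v =>
      Equiv.Perm.mem_support.2 (hσ.apply_ne nontrivial_univ (mem_univ v))
    rw [hcycle.cycleType, hsupport, Finset.card_univ]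
  · have hcycle : σ.IsCycle := by
      rw [← Equiv.Perm.card_cycleType_eq_one, hσ, Multiset.card_singleton]
    have hsupport : σ.support = Finset.univ := by
      rw [← Finset.card_eq_iff_eq_univ, ← Equiv.Perm.sum_cycleType, hσ, Multiset.sum_singleton]
    convert! hcycle.isCycleOn using 1
    ext v
    simpa using Finset.ext_iff.1 hsupport v

theorem card_isCycleOn_univ [Finite V] [Nontrivial V] :
    Nat.card {σ : Equiv.Perm V // σ.IsCycleOn univ} = (Nat.card V - 1).factorial := by
  classical
  have := Fintype.ofFinite V
  have hcard := Equiv.Perm.card_of_cycleType_singleton (Fintype.one_lt_card (α := V)) le_rfl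
  rw [Nat.choose_self, mul_one, ← Fintype.card_subtype, ← Nat.card_eq_fintype_card] at hcard
  rw [Nat.card_eq_fintype_card (α := V)]
  exact (Nat.card_congr (Equiv.subtypeEquivRight fun _ => isCycleOn_univ_iff_cycleType)).trans hcard

theorem two_mul_card_connected_twoRegular [Finite V] (hV : 3 ≤ Nat.card V) :
    2 * Nat.card {G : SimpleGraph V // (∀ v, (G.neighborSet v).ncard = 2) ∧ G.Connected} =
      (Nat.card V - 1).factorial := by
  classical
  have : Nontrivial V := Finite.one_lt_card_iff_nontrivial.1 (by omega)
  have := Fintype.ofFinite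
    {G : SimpleGraph V // (∀ v, (G.neighborSet v).ncard = 2) ∧ G.Connected}
  let graphOf : {σ : Equiv.Perm V // σ.IsCycleOn univ} →
      {G : SimpleGraph V // (∀ v, (G.neighborSet v).ncard = 2) ∧ G.Connected} := fun σ =>
    ⟨permGraph σ.1, ncard_neighborSet_permGraph (apply_apply_ne_of_isCycleOn_univ σ.2 hV),
      connected_permGraph σ.2⟩
  have hfiber : ∀ G, Nat.card {σ // graphOf σ = G} = 2 := by
    intro G
    obtain ⟨σ, hσ, hσG⟩ := exists_permGraph_eq hV G.2.1 G.2.2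
    have hpair : {τ | graphOf τ = G} = {⟨σ, hσ⟩, ⟨σ⁻¹, hσ.inv⟩} := by
      ext τ
      simp only [mem_ofPred_eq, mem_insert_iff, mem_singleton_iff, Subtype.ext_iff, graphOf, ← hσG]
      exact permGraph_eq_permGraph_iff hV hσ τ.2
    have hne : (⟨σ, hσ⟩ : {σ : Equiv.Perm V // σ.IsCycleOn univ}) ≠ ⟨σ⁻¹, hσ.inv⟩ := by
      obtain ⟨v⟩ := G.2.2.nonempty
      rw [Ne, Subtype.mk.injEq, ← mul_eq_one_iff_eq_inv]
      exact fun h => apply_apply_ne_of_isCycleOn_univ hσ hV v (congrArg (fun τ => τ v) h)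
    exact (congrArg Set.ncard hpair).trans (Set.ncard_pair hne)
  rw [← card_isCycleOn_univ, ← Nat.card_congr (Equiv.sigmaFiberEquiv graphOf),
    Nat.card_sigma, Finset.sum_congr rfl fun G _ => hfiber G, Finset.sum_const, Finset.card_univ,
    smul_eq_mul, mul_comm, Nat.card_eq_fintype_card]

end CyclicPermutations

namespace RelationClass

/-- The class of adjacency relations of simple graphs all of whose vertices have degree two. -/
def TwoRegular : RelationClass := fun V r =>
  (∀ a b, r a b → r b a) ∧ (∀ a, ¬ r a a) ∧ HasOutDegree 2 V r

theorem isDecomposable_symmetric : IsDecomposable fun _ r => ∀ a b, r a b → r b a where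
  congr _ _ h _ _ hab := h _ _ hab
  split S r h := by
    refine ⟨fun hr => ⟨fun a b => hr a b, fun a b => hr a b⟩, fun hr a b hab => ?_⟩
    by_cases ha : a ∈ S
    · exact hr.1 ⟨a, ha⟩ ⟨b, (h a b hab).1 ha⟩ hab
    · exact hr.2 ⟨a, ha⟩ ⟨b, (not_congr (h a b hab)).1 ha⟩ hab

theorem isDecomposable_irreflexive : IsDecomposable fun _ r => ∀ a, ¬ r a a where
  congr _ _ h _ := h _
  split S r _ := by
    refine ⟨fun hr => ⟨fun a => hr a, fun a => hr a⟩, fun hr a => ?_⟩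
    by_cases ha : a ∈ S
    · exact hr.1 ⟨a, ha⟩
    · exact hr.2 ⟨a, ha⟩

theorem isDecomposable_twoRegular : TwoRegular.IsDecomposable :=
  isDecomposable_symmetric.and (isDecomposable_irreflexive.and (isDecomposable_hasOutDegree 2))

/-- A `2`-regular graph, viewed as its adjacency relation. -/
def twoRegularEquiv (V : Type) :
    {G : SimpleGraph V // ∀ v, (G.neighborSet v).ncard = 2} ≃
      {r : V → V → Prop // TwoRegular V r} where
  toFun G := ⟨G.1.Adj, fun _ _ h => h.symm, fun _ => G.1.irrefl, G.2⟩
  invFun r := ⟨⟨r.1, ⟨r.2.1⟩, ⟨r.2.2.1⟩⟩, r.2.2.2⟩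

theorem fromRel_twoRegularEquiv {V : Type}
    (G : {G : SimpleGraph V // ∀ v, (G.neighborSet v).ncard = 2}) :
    SimpleGraph.fromRel (twoRegularEquiv V G).1 = G := by
  ext a b
  exact ⟨fun h => h.2.elim id .symm, fun h => ⟨h.ne, .inl h⟩⟩

theorem two_mul_connectedCount_twoRegular {k : ℕ} (hk : 3 ≤ k) :
    2 * TwoRegular.connectedCount k = (k - 1).factorial := by
  have h := two_mul_card_connected_twoRegular (V := Fin k) (by rwa [Nat.card_fin])
  rw [Nat.card_fin] at h
  rw [← h, connectedCount, ← Nat.card_congr (Equiv.subtypeSubtypeEquivSubtypeInter _ _),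
    ← Nat.card_congr (Equiv.subtypeSubtypeEquivSubtypeInter _ _)]
  congr 1
  exact (Nat.card_congr ((twoRegularEquiv (Fin k)).subtypeEquiv fun G => by
    rw [fromRel_twoRegularEquiv])).symm

theorem connectedCount_twoRegular_eq_zero {k : ℕ} (hk : k < 3) :
    TwoRegular.connectedCount k = 0 := by
  rw [connectedCount, Nat.card_eq_zero]
  refine .inl ⟨fun ⟨r, ⟨_, hirrefl, hdeg⟩, hconn⟩ => ?_⟩
  obtain ⟨v⟩ := hconn.nonempty
  have hlt : {b | r v b}.ncard < (univ : Set (Fin k)).ncard :=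
    Set.ncard_lt_ncard ((Set.ssubset_univ_iff).2 fun h =>
      hirrefl v ((Set.ext_iff.1 h v).2 (mem_univ v)))
  rw [hdeg, Set.ncard_univ, Nat.card_fin] at hlt
  omega

theorem tendsto_connectedCount_twoRegular :
    Tendsto (fun k : ℕ => (k : ℝ) * (TwoRegular.connectedCount k / (k.factorial * 1 ^ k)))
      atTop (𝓝 (1 / 2)) := by
  refine tendsto_const_nhds.congr' ?_
  filter_upwards [eventually_ge_atTop 3] with k hk
  have hcount : 2 * (TwoRegular.connectedCount k : ℝ) = (k - 1).factorial := by
    exact_mod_cast two_mul_connectedCount_twoRegular hk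
  have hfact : (k.factorial : ℝ) = k * (k - 1).factorial := by
    exact_mod_cast (Nat.mul_factorial_pred (by omega)).symm
  have hcount₀ : (TwoRegular.connectedCount k : ℝ) ≠ 0 := fun h => by
    rw [h, mul_zero, eq_comm, Nat.cast_eq_zero] at hcount
    exact Nat.factorial_ne_zero _ hcount
  rw [hfact, one_pow, ← hcount]
  field_simp

end RelationClass

theorem natCast_rpow_le_mul_rpow {j n : ℕ} (hj : j ≤ n) {α : ℝ} (hα : 0 ≤ α) :
    (n : ℝ) ^ α ≤ ((j : ℝ) + 1) ^ α * (((n - j : ℕ) : ℝ) + 1) ^ α := by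
  rw [← Real.mul_rpow (by positivity) (by positivity)]
  refine Real.rpow_le_rpow (by positivity) ?_ hα
  obtain ⟨k, rfl⟩ := Nat.exists_eq_add_of_le hj
  rw [Nat.add_sub_cancel_left]
  push_cast
  nlinarith [mul_nonneg (Nat.cast_nonneg (α := ℝ) j) (Nat.cast_nonneg (α := ℝ) k)]

/-- Tannery's theorem; `n ≤ (j + 1) (n - j + 1)` provides the dominating series. -/
theorem tendsto_coeff_mul_mul_rpow {f g : PowerSeries ℝ} {α L : ℝ} (hα : 0 ≤ α)
    (hf : Summable fun j : ℕ => |f.coeff j| * ((j : ℝ) + 1) ^ α)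
    (hg : Tendsto (fun n : ℕ => g.coeff n * (n : ℝ) ^ α) atTop (𝓝 L)) :
    Tendsto (fun n : ℕ => (f * g).coeff n * (n : ℝ) ^ α) atTop (𝓝 ((∑' j, f.coeff j) * L)) := by
  obtain ⟨M, hM⟩ := exists_forall_abs_mul_rpow_le hg
  let summand (n j : ℕ) : ℝ :=
    if j ≤ n then f.coeff j * (g.coeff (n - j) * (n : ℝ) ^ α) else 0
  have htsum (n : ℕ) : ∑' j, summand n j = (f * g).coeff n * (n : ℝ) ^ α := by
    rw [PowerSeries.coeff_mul, Finset.Nat.sum_antidiagonal_eq_sum_range_succ_mk, Finset.sum_mul,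
      tsum_eq_sum (s := Finset.range (n + 1)) fun j hj => if_neg (by simpa using hj)]
    refine Finset.sum_congr rfl fun j hj => ?_
    rw [mul_assoc]
    exact if_pos (Finset.mem_range_succ_iff.1 hj)
  rw [← tsum_mul_right]
  refine (tendsto_tsum_of_dominated_convergence (hf.mul_right M) (fun j => ?_)
    (.of_forall fun n j => ?_)).congr htsum
  · have hj := (tendsto_mul_rpow_comp_sub hg j 0 (by simp)).const_mul (f.coeff j)
    refine hj.congr' ?_
    filter_upwards [eventually_ge_atTop j] with n hn
    rw [add_zero]
    exact (if_pos hn).symm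
  · have hM₀ : 0 ≤ M := (by positivity : (0 : ℝ) ≤ _).trans (hM 0)
    by_cases hj : j ≤ n
    · calc ‖summand n j‖ = |f.coeff j| * (|g.coeff (n - j)| * (n : ℝ) ^ α) := by
            rw [show summand n j = _ from if_pos hj, norm_mul, norm_mul,
              Real.norm_of_nonneg (by positivity : 0 ≤ (n : ℝ) ^ α), Real.norm_eq_abs,
              Real.norm_eq_abs]
        _ ≤ |f.coeff j| *
            (|g.coeff (n - j)| * (((j : ℝ) + 1) ^ α * (((n - j : ℕ) : ℝ) + 1) ^ α)) := by
          gcongr; exact natCast_rpow_le_mul_rpow hj hα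
        _ = |f.coeff j| * ((j : ℝ) + 1) ^ α *
            (|g.coeff (n - j)| * (((n - j : ℕ) : ℝ) + 1) ^ α) := by ring
        _ ≤ |f.coeff j| * ((j : ℝ) + 1) ^ α * M := by gcongr; exact hM _
    · rw [show summand n j = 0 from if_neg hj, norm_zero]
      positivity

theorem stirlingSeq_two_mul_div_sq {n : ℕ} (hn : n ≠ 0) :
    Stirling.stirlingSeq (2 * n) / Stirling.stirlingSeq n ^ 2 = n.centralBinom / 4 ^ n * √n := by
  have hsqrt : √(2 * (2 * n : ℝ)) = 2 * √n := by
    rw [← mul_assoc, Real.sqrt_mul (by norm_num), show (2 : ℝ) * 2 = 2 ^ 2 by norm_num,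
      Real.sqrt_sq two_pos.le]
  have hfactorial : ((2 * n).factorial : ℝ) = n.centralBinom * n.factorial ^ 2 := by
    have h := Nat.choose_mul_factorial_mul_factorial (show n ≤ 2 * n by omega)
    rw [← Nat.centralBinom_eq_two_mul_choose, two_mul, Nat.add_sub_cancel_left, mul_assoc,
      ← pow_two] at h
    rw [two_mul, ← h, Nat.cast_mul, Nat.cast_pow]
  have hpow : (2 * (n : ℝ) / Real.exp 1) ^ (2 * n) = 4 ^ n * ((n / Real.exp 1) ^ n) ^ 2 := by
    rw [mul_div_assoc, mul_pow, pow_mul 2 2 n, ← pow_mul (_ / _) n 2, mul_comm n 2]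
    norm_num
  rw [Stirling.stirlingSeq, Stirling.stirlingSeq, Nat.cast_mul, Nat.cast_two, hsqrt, hfactorial,
    hpow, div_pow (n.factorial : ℝ), mul_pow √_, Real.sq_sqrt (by positivity)]
  have hn₀ : (0 : ℝ) < n := by positivity
  field_simp
  rw [Real.sq_sqrt hn₀.le]

theorem tendsto_centralBinom_div_four_pow_mul_sqrt :
    Tendsto (fun n : ℕ => (n.centralBinom : ℝ) / 4 ^ n * √n) atTop (𝓝 (√Real.pi)⁻¹) := by
  have hstirling := Stirling.tendsto_stirlingSeq_sqrt_pi
  have htwo : Tendsto (fun n : ℕ => 2 * n) atTop atTop := tendsto_id.const_mul_atTop' two_pos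
  have h := (hstirling.comp htwo).div (hstirling.pow 2) (by positivity)
  rw [show √Real.pi / √Real.pi ^ 2 = (√Real.pi)⁻¹ by field_simp] at h
  refine h.congr' ?_
  filter_upwards [eventually_ne_atTop 0] with n hn
  exact stirlingSeq_two_mul_div_sq hn

section PowerSeriesODE

open PowerSeries

/-- The power series of `(1 - X) ^ (-1 / 2)`. -/
noncomputable def invSqrtOneSub : ℝ⟦X⟧ := mk fun n => n.centralBinom / 4 ^ n

theorem one_sub_mul_derivative_invSqrtOneSub :
    (1 - X) * derivative ℝ invSqrtOneSub = C (1 / 2) * invSqrtOneSub := by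
  ext n
  have hrec : ∀ m : ℕ, ((m : ℝ) + 1) * (m + 1).centralBinom = 2 * (2 * m + 1) * m.centralBinom :=
    fun m => by exact_mod_cast m.succ_mul_centralBinom_succ
  rw [coeff_C_mul, sub_mul, one_mul, map_sub, coeff_derivative]
  cases n with
  | zero =>
    rw [coeff_zero_X_mul]
    simp [invSqrtOneSub, Nat.centralBinom]
    norm_num
  | succ n =>
    have h := hrec (n + 1)
    push_cast at h ⊢
    rw [coeff_succ_X_mul, coeff_derivative, invSqrtOneSub, coeff_mk, coeff_mk, pow_succ]
    field_simp
    linear_combination 2 * h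

end PowerSeriesODE

namespace RelationClass

open PowerSeries

theorem one_sub_mul_derivative_egf_connectedCount_twoRegular :
    (1 - X) * derivative ℝ (egf TwoRegular.connectedCount) = C (1 / 2) * X ^ 2 := by
  have h : derivative ℝ (egf TwoRegular.connectedCount) = C (1 / 2) * X ^ 2 * mk 1 := by
    ext k
    rw [coeff_derivative_egf, mul_assoc, coeff_C_mul, coeff_X_pow_mul']
    split_ifs with hk
    · have hcount : 2 * (TwoRegular.connectedCount (k + 1) : ℝ) = k.factorial := by
        exact_mod_cast two_mul_connectedCount_twoRegular (by omega : 3 ≤ k + 1)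
      have hfactorial : (k.factorial : ℝ) ≠ 0 := by positivity
      rw [coeff_mk, Pi.one_apply, mul_one, div_eq_div_iff hfactorial two_ne_zero, ← hcount]
      ring
    · rw [connectedCount_twoRegular_eq_zero (by omega), Nat.cast_zero, zero_div, mul_zero]
  rw [h, mul_comm, mul_assoc, mk_one_mul_one_sub_eq_one, mul_one]

/-- The exponential generating function of the `2`-regular graphs divided by
`(1 - X) ^ (-1 / 2)`; it is the power series of `exp (-X / 2 - X ^ 2 / 4)`. -/
noncomputable def twoRegularCofactor : ℝ⟦X⟧ :=
  egf TwoRegular.totalCount * invSqrtOneSub⁻¹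

theorem constantCoeff_invSqrtOneSub : constantCoeff invSqrtOneSub = 1 := by
  rw [← coeff_zero_eq_constantCoeff_apply, invSqrtOneSub, coeff_mk]
  simp

theorem twoRegularCofactor_mul_invSqrtOneSub :
    twoRegularCofactor * invSqrtOneSub = egf TwoRegular.totalCount := by
  rw [twoRegularCofactor, mul_assoc, PowerSeries.inv_mul_cancel _
    (by rw [constantCoeff_invSqrtOneSub]; exact one_ne_zero), mul_one]

theorem derivative_twoRegularCofactor :
    derivative ℝ twoRegularCofactor = -C (1 / 2) * (1 + X) * twoRegularCofactor := by
  have hne : (1 - X : ℝ⟦X⟧) ≠ 0 := fun h => by simpa using congrArg constantCoeff h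
  refine mul_left_cancel₀ hne ?_
  have htotal := isDecomposable_twoRegular.derivative_egf_totalCount
  have hconnected := one_sub_mul_derivative_egf_connectedCount_twoRegular
  have hinv := one_sub_mul_derivative_invSqrtOneSub
  have hcancel : invSqrtOneSub⁻¹ * invSqrtOneSub = 1 := PowerSeries.inv_mul_cancel _
    (by rw [constantCoeff_invSqrtOneSub]; exact one_ne_zero)
  rw [twoRegularCofactor, Derivation.leibniz, smul_eq_mul, smul_eq_mul, htotal, derivative_inv']
  linear_combination egf TwoRegular.totalCount * invSqrtOneSub⁻¹ * hconnected
    - egf TwoRegular.totalCount * invSqrtOneSub⁻¹ ^ 2 * hinv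
    - C (1 / 2) * egf TwoRegular.totalCount * invSqrtOneSub⁻¹ * hcancel

theorem totalCount_twoRegular_zero : TwoRegular.totalCount 0 = 1 := by
  rw [totalCount, Nat.card_eq_one_iff_unique]
  exact ⟨⟨fun r s => Subtype.ext (funext fun a => a.elim0)⟩,
    ⟨⟨fun a => a.elim0, fun a => a.elim0, fun a => a.elim0, fun a => a.elim0⟩⟩⟩

theorem coeff_zero_twoRegularCofactor : coeff 0 twoRegularCofactor = 1 := by
  rw [coeff_zero_eq_constantCoeff_apply, twoRegularCofactor, map_mul,
    PowerSeries.constantCoeff_inv, constantCoeff_invSqrtOneSub,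
    ← coeff_zero_eq_constantCoeff_apply, egf, coeff_mk, totalCount_twoRegular_zero]
  simp

theorem coeff_one_twoRegularCofactor : coeff 1 twoRegularCofactor = -1 / 2 := by
  have h := congrArg (coeff 0) derivative_twoRegularCofactor
  rw [coeff_derivative, ← map_neg, mul_assoc, coeff_C_mul, add_mul, one_mul, map_add,
    coeff_zero_X_mul, coeff_zero_twoRegularCofactor] at h
  norm_num at h ⊢
  exact h

theorem coeff_add_two_twoRegularCofactor (n : ℕ) : coeff (n + 2) twoRegularCofactor =
    -(coeff (n + 1) twoRegularCofactor + coeff n twoRegularCofactor) / (2 * (n + 2)) := by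
  have h := congrArg (coeff (n + 1)) derivative_twoRegularCofactor
  rw [coeff_derivative, ← map_neg, mul_assoc, coeff_C_mul, add_mul, one_mul, map_add,
    coeff_succ_X_mul] at h
  push_cast at h
  rw [eq_div_iff (by positivity)]
  linear_combination 2 * h

theorem coeff_two_twoRegularCofactor : coeff 2 twoRegularCofactor = -1 / 8 := by
  have h := coeff_add_two_twoRegularCofactor 0
  rw [zero_add, zero_add, coeff_one_twoRegularCofactor, coeff_zero_twoRegularCofactor] at h
  norm_num at h ⊢
  exact h

theorem abs_coeff_twoRegularCofactor_le (n : ℕ) :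
    |coeff n twoRegularCofactor| ≤ (1 / 2) ^ n := by
  induction n using Nat.strong_induction_on with
  | _ n ih =>
    match n with
    | 0 => simp [coeff_zero_twoRegularCofactor]
    | 1 => norm_num [coeff_one_twoRegularCofactor]
    | 2 => norm_num [coeff_two_twoRegularCofactor]
    | n + 3 =>
      have hden : (0 : ℝ) < 2 * ((n + 1 : ℕ) + 2) := by positivity
      rw [coeff_add_two_twoRegularCofactor (n + 1), abs_div, abs_neg, abs_of_pos hden,
        div_le_iff₀ hden]
      calc |coeff (n + 2) twoRegularCofactor + coeff (n + 1) twoRegularCofactor|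
          ≤ (1 / 2) ^ (n + 2) + (1 / 2) ^ (n + 1) :=
            (abs_add_le _ _).trans (add_le_add (ih _ (by omega)) (ih _ (by omega)))
        _ = (1 / 2) ^ (n + 3) * (2 * (1 + 2)) := by ring
        _ ≤ (1 / 2) ^ (n + 3) * (2 * ((n + 1 : ℕ) + 2)) := by gcongr; simp

theorem summable_abs_coeff_twoRegularCofactor_mul_rpow :
    Summable fun j : ℕ => |coeff j twoRegularCofactor| * ((j : ℝ) + 1) ^ (1 / 2 : ℝ) := by
  have hhalf : ‖(1 / 2 : ℝ)‖ < 1 := by norm_num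
  have hgeom : Summable fun j : ℕ => ((j : ℝ) + 1) * (1 / 2 : ℝ) ^ j := by
    simpa [add_mul] using (summable_pow_mul_geometric_of_norm_lt_one 1 hhalf).add
      (summable_geometric_of_norm_lt_one hhalf)
  refine hgeom.of_nonneg_of_le (fun j => by positivity) fun j => ?_
  rw [mul_comm]
  gcongr
  · exact Real.rpow_le_self_of_one_le (by simp) (by norm_num)
  · exact abs_coeff_twoRegularCofactor_le j

theorem tsum_coeff_twoRegularCofactor_pos : 0 < ∑' j, coeff j twoRegularCofactor := by
  have hgeom : HasSum (fun j : ℕ => (1 / 2 : ℝ) ^ (j + 3)) (1 / 4) := by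
    have h := hasSum_geometric_two.mul_right ((1 / 2 : ℝ) ^ 3)
    norm_num [pow_add] at h ⊢
    exact h
  have hsummable : Summable fun j => coeff j twoRegularCofactor :=
    (summable_geometric_two.of_nonneg_of_le (fun _ => abs_nonneg _)
      abs_coeff_twoRegularCofactor_le).of_abs
  have htail : ‖∑' j, coeff (j + 3) twoRegularCofactor‖ ≤ 1 / 4 :=
    tsum_of_norm_bounded hgeom fun j => abs_coeff_twoRegularCofactor_le (j + 3)
  rw [← hsummable.sum_add_tsum_nat_add 3, Finset.sum_range_succ, Finset.sum_range_succ,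
    Finset.sum_range_one, coeff_zero_twoRegularCofactor, coeff_one_twoRegularCofactor,
    coeff_two_twoRegularCofactor]
  linarith [neg_le_of_abs_le htail]

theorem tendsto_totalCount_twoRegular :
    Tendsto (fun n : ℕ => (TwoRegular.totalCount n : ℝ) / (n.factorial * 1 ^ n) *
      (n : ℝ) ^ (1 / 2 : ℝ)) atTop
      (𝓝 ((∑' j, coeff j twoRegularCofactor) * (√Real.pi)⁻¹)) := by
  have h := tendsto_coeff_mul_mul_rpow (g := invSqrtOneSub) (by norm_num)
    summable_abs_coeff_twoRegularCofactor_mul_rpow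
    (by simpa only [invSqrtOneSub, coeff_mk, ← Real.sqrt_eq_rpow] using
      tendsto_centralBinom_div_four_pow_mul_sqrt)
  simpa only [twoRegularCofactor_mul_invSqrtOneSub, egf, coeff_mk, one_pow, mul_one] using h

end RelationClass

/-! ### The limit laws -/

theorem tendsto_median_div_limit_constant {α : ℕ → Type*} [∀ n, Finite (α n)]
    {X : ∀ n, α n → ℕ} (hX : ∀ x ∈ Icc (1 / 2 : ℝ) 1,
      Tendsto (fun n : ℕ => uniformProb fun a => x * n < (X n a : ℝ)) atTop
        (𝓝 (∫ y in x..1, 1 / (2 * y * √(1 - y)))))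
    {ν : ℕ → ℝ} (hν : ∀ᶠ n in atTop, IsMedian (X n) (ν n)) :
    Tendsto (fun n : ℕ => ν n / n) atTop (𝓝 (4 * Real.exp 1 / (1 + Real.exp 1) ^ 2)) := by
  have hmem : Icc (1 / 2 : ℝ) 1 ∈ 𝓝 (4 * Real.exp 1 / (1 + Real.exp 1) ^ 2) :=
    Icc_mem_nhds (by linarith [limit_constant_bounds.1]) (by linarith [limit_constant_bounds.2])
  exact tendsto_median_div (tendsto_natCast_atTop_atTop.eventually_gt_atTop 0) hmem
    (strictAntiOn_integral_tail.mono fun x hx => ⟨by linarith [hx.1], hx.2⟩)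
    integral_tail_limit_constant hX hν

theorem half_div_mul_one_sub_rpow_half (y : ℝ) :
    1 / 2 / (y * (1 - y) ^ (1 / 2 : ℝ)) = 1 / (2 * y * √(1 - y)) := by
  rw [Real.sqrt_eq_rpow, div_div, ← mul_assoc]

theorem tendsto_uniformProb_lt_largest_mapping {x : ℝ} (hx : x ∈ Icc (1 / 2) 1) :
    Tendsto (fun n : ℕ => uniformProb fun f : Mapping n => x * n < (Mapping.largest f : ℝ)) atTop
      (𝓝 (∫ y in x..1, 1 / (2 * y * √(1 - y)))) := by
  simp only [← half_div_mul_one_sub_rpow_half]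
  refine ((RelationClass.isDecomposable_hasOutDegree 1).tendsto_uniformProb_lt_largestComponent
    (by norm_num) (Real.exp_ne_zero 1) (by positivity)
    RelationClass.tendsto_totalCount_hasOutDegree_one
    RelationClass.tendsto_connectedCount_hasOutDegree_one hx).congr fun n => ?_
  exact (uniformProb_congr (RelationClass.mapEquiv (Fin n)) fun f => Iff.rfl).symm

theorem isRegularOfDegree_iff_ncard_neighborSet {V : Type*} {G : SimpleGraph V} [G.LocallyFinite]
    {d : ℕ} : G.IsRegularOfDegree d ↔ ∀ v, (G.neighborSet v).ncard = d :=
  forall_congr' fun v => by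
    rw [← SimpleGraph.card_neighborSet_eq_degree, ← Nat.card_eq_fintype_card, Nat.card_coe_set_eq]

/-- A `2`-regular graph on `n` labeled vertices as an adjacency relation. -/
noncomputable def twoRegularGraphEquiv (n : ℕ) :
    TwoRegularGraph n ≃ {r : Fin n → Fin n → Prop // RelationClass.TwoRegular _ r} :=
  (Equiv.subtypeEquivRight fun _ => by
    classical exact isRegularOfDegree_iff_ncard_neighborSet).trans
    (RelationClass.twoRegularEquiv (Fin n))

instance finite_twoRegularGraph (n : ℕ) : Finite (TwoRegularGraph n) :=
  Finite.of_equiv _ (twoRegularGraphEquiv n).symm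

theorem nonempty_twoRegularGraph {n : ℕ} (hn : 3 ≤ n) : Nonempty (TwoRegularGraph n) := by
  obtain ⟨m, rfl⟩ := Nat.exists_eq_add_of_le' hn
  refine ⟨SimpleGraph.cycleGraph (m + 3), fun v => ?_⟩
  convert SimpleGraph.cycleGraph_degree_three_le (v := v)

theorem tendsto_uniformProb_lt_largest_twoRegularGraph {x : ℝ} (hx : x ∈ Icc (1 / 2) 1) :
    Tendsto (fun n : ℕ => uniformProb fun G : TwoRegularGraph n =>
        x * n < (TwoRegularGraph.largest G : ℝ)) atTop
      (𝓝 (∫ y in x..1, 1 / (2 * y * √(1 - y)))) := by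
  simp only [← half_div_mul_one_sub_rpow_half]
  refine (RelationClass.isDecomposable_twoRegular.tendsto_uniformProb_lt_largestComponent
    (by norm_num) one_ne_zero
    (mul_pos RelationClass.tsum_coeff_twoRegularCofactor_pos (by positivity)).ne'
    RelationClass.tendsto_totalCount_twoRegular
    RelationClass.tendsto_connectedCount_twoRegular hx).congr fun n => ?_
  refine (uniformProb_congr (twoRegularGraphEquiv n) fun G => ?_).symm
  rw [show SimpleGraph.fromRel (twoRegularGraphEquiv n G).1 = G.1 from
    RelationClass.fromRel_twoRegularEquiv _]
  rfl

end RandomStructures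

theorem mainTheorem2 :
    -- random mappings: medians exist, every choice of medians has the stated limit
    ((∀ n : ℕ, 1 ≤ n →
        ∃ m : ℝ, RandomStructures.IsMedian
          (fun f : RandomStructures.Mapping n => RandomStructures.Mapping.largest f) m) ∧
      (∀ ν : ℕ → ℝ,
        (∀ᶠ n : ℕ in Filter.atTop, RandomStructures.IsMedian
          (fun f : RandomStructures.Mapping n => RandomStructures.Mapping.largest f) (ν n)) →
        Filter.Tendsto (fun n : ℕ => ν n / (n : ℝ)) Filter.atTop
          (nhds (4 * Real.exp 1 / (1 + Real.exp 1) ^ 2))) ∧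
      (∀ x : ℝ, x ∈ Set.Icc (1 / 2 : ℝ) 1 →
        Filter.Tendsto
          (fun n : ℕ => RandomStructures.uniformProb
            (fun f : RandomStructures.Mapping n =>
              x * (n : ℝ) < (RandomStructures.Mapping.largest f : ℝ)))
          Filter.atTop (nhds (∫ y in x..1, 1 / (2 * y * Real.sqrt (1 - y)))))) ∧
    -- random 2-regular labeled graphs, which exist for `3 ≤ n`
    ((∀ n : ℕ, 3 ≤ n →
        ∃ m : ℝ, RandomStructures.IsMedian
          (fun G : RandomStructures.TwoRegularGraph n =>
            RandomStructures.TwoRegularGraph.largest G) m) ∧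
      (∀ ν : ℕ → ℝ,
        (∀ᶠ n : ℕ in Filter.atTop, RandomStructures.IsMedian
          (fun G : RandomStructures.TwoRegularGraph n =>
            RandomStructures.TwoRegularGraph.largest G) (ν n)) →
        Filter.Tendsto (fun n : ℕ => ν n / (n : ℝ)) Filter.atTop
          (nhds (4 * Real.exp 1 / (1 + Real.exp 1) ^ 2))) ∧
      (∀ x : ℝ, x ∈ Set.Icc (1 / 2 : ℝ) 1 →
        Filter.Tendsto
          (fun n : ℕ => RandomStructures.uniformProb
            (fun G : RandomStructures.TwoRegularGraph n =>
              x * (n : ℝ) < (RandomStructures.TwoRegularGraph.largest G : ℝ)))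
          Filter.atTop (nhds (∫ y in x..1, 1 / (2 * y * Real.sqrt (1 - y)))))) ∧
    -- the decimal value of the limit
    (0.78644773296592741014 ≤ 4 * Real.exp 1 / (1 + Real.exp 1) ^ 2 ∧
      4 * Real.exp 1 / (1 + Real.exp 1) ^ 2 < 0.78644773296592741015) := by
  refine ⟨⟨fun n hn => ?_, fun ν hν => ?_, fun x hx => ?_⟩,
    ⟨fun n hn => ?_, fun ν hν => ?_, fun x hx => ?_⟩, RandomStructures.limit_constant_bounds⟩
  · have : NeZero n := ⟨by omega⟩
    exact RandomStructures.exists_isMedian _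
  · exact RandomStructures.tendsto_median_div_limit_constant
      (fun x hx => RandomStructures.tendsto_uniformProb_lt_largest_mapping hx) hν
  · exact RandomStructures.tendsto_uniformProb_lt_largest_mapping hx
  · have := RandomStructures.nonempty_twoRegularGraph hn
    exact RandomStructures.exists_isMedian _
  · exact RandomStructures.tendsto_median_div_limit_constant
      (fun x hx => RandomStructures.tendsto_uniformProb_lt_largest_twoRegularGraph hx) hν
  · exact RandomStructures.tendsto_uniformProb_lt_largest_twoRegularGraph hx
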